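/- **Setting.** Write $\mathbb R_+=[0,\infty)$. A function $\gamma:\mathbb R_+\to\mathbb R_+$ is of class $\mathcal P$ if it is continuous, $\gamma(0)=0$ and $\gamma(r)>0$ for $r>0$; of class $\mathcal K$ if in addition it is strictly increasing; of class $\mathcal K_\infty$ if in addition it is unbounded. A continuous $\beta:\mathbb R_+^2\to\mathbb R_+$ is of class $\mathcal{KL}$ if $\beta(\cdot,t)\in\mathcal K$ for all $t\ge 0$ and, for all $r>0$, $\beta(r,\cdot)$ is strictly decreasing with limit $0$ at infinity. For $i\in\mathbb N$ let $E_i$ and $W_i$ be finite-dimensional real normed spaces ($\mathbb R^{n_i}$ and $\mathbb R^{m_i}$ with arbitrary norms $|\cdot|$), let $I_i\subset\mathbb N\setminus\{i\}$ be finite, and let $f_i:E_i\times\prod_{j\in I_i}E_j\times W_i\to E_i$ be continuous. Consider the subsystems $\Sigma_i:\ \dot x_i=f_i(x_i,\bar x_i,u_i)$, $\bar x_i=(x_j)_{j\in I_i}$. Let $X$ be the Banach space of all $x=(x_i)$, $x_i\in E_i$, with $\|x\|_X:=\sup_i|x_i|<\infty$, and let $U$ be the analogous space of all bounded $u=(u_i)$,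 $u_i\in W_i$. The set $\mathcal U$ of inputs consists of all $u\in L_\infty(\mathbb R_+,U)$ that are piecewise right-continuous, i.e. continuous on each interval of some partition $\mathbb R_+=[0,t_1)\cup[t_1,t_2)\cup\cdots$, with norm $\|u\|_{\mathcal U}=\operatorname{ess\,sup}_{t\ge0}\|u(t)\|_U$. Put $f(x,u)=(f_i(x_i,\bar x_i,u_i))_i\in\prod_iE_i$. A solution of $\Sigma:\ \dot x=f(x,u)$, $x(0)=x^0\in X$, for $u\in\mathcal U$, is a map $\lambda:[0,T)\to X$, $0<T\le\infty$, such that $s\mapsto f(\lambda(s),u(s))$ is $X$-valued and locally Bochner integrable on $[0,T)$ and $\lambda(t)=x^0+\int_0^tf(\lambda(s),u(s))\,ds$ for all $t\in[0,T)$. $\Sigma$ is *well-posed* if for all $(x^0,u)\in X\times\mathcal U$ there is a unique maximal (i.e. non-extendable) solution, denoted $\phi(\cdot,x^0,u):[0,t_{\max}(x^0,u))\to X$. $\Sigma$ has the *BIC property* if $t_{\max}(x^0,u)=\infty$ whenever $\phi(\cdot,x^0,u)$ is bounded. A well-posed $\Sigma$ is *ISS* if $t_{\max}\equiv\infty$ and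 there are $\beta\in\mathcal{KL}$, $\gamma\in\mathcal K_\infty$ with $\|\phi(t,x,u)\|_X\le\beta(\|x\|_X,t)+\gamma(\|u\|_{\mathcal U})$ for all $t\ge 0$, $x\in X$, $u\in\mathcal U$. An *ISS Lyapunov function* for $\Sigma$ is a continuous $V:X\to\mathbb R_+$ such that $\psi_1(\|x\|_X)\le V(x)\le\psi_2(\|x\|_X)$ for some $\psi_1,\psi_2\in\mathcal K_\infty$ and all $x\in X$, and such that for some $\gamma\in\mathcal K$, $\alpha\in\mathcal P$ and all $x\in X$, $u\in\mathcal U$, $$V(x)>\gamma(\|u\|_{\mathcal U})\ \Rightarrow\ \limsup_{t\to0^+}\frac{V(\phi(t,x,u))-V(x)}{t}\le-\alpha(V(x)).$$ **Theorem.** Assume: (i) $\Sigma$ is well-posed and has the BIC property. (ii) For each $i$ there are a continuous $V_i:E_i\to\mathbb R_+$ that is $C^1$ on $E_i\setminus\{0\}$, functions $\psi_{i1},\psi_{i2}\in\mathcal K_\infty$ with $\psi_{i1}(|x_i|)\le V_i(x_i)\le\psi_{i2}(|x_i|)$ for all $x_i\in E_i$, internal gains $\gamma_{ij}\in\mathcal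 K\cup\{0\}$ ($j\in\mathbb N$) with $\gamma_{ij}=0$ for $j\notin I_i$, an external gain $\gamma_{iu}\in\mathcal K$ and $\alpha_i\in\mathcal P$ such that for all $x\in X$, $u\in U$ $$V_i(x_i)>\max\Bigl\{\sup_{j\in I_i}\gamma_{ij}(V_j(x_j)),\gamma_{iu}(|u_i|)\Bigr\}\ \Rightarrow\ \nabla V_i(x_i)f_i(x_i,\bar x_i,u_i)\le-\alpha_i(V_i(x_i)).$$ Moreover there are $\psi_1,\psi_2\in\mathcal K_\infty$ with $\psi_1\le\psi_{i1}$ and $\psi_{i2}\le\psi_2$ for all $i$. (iii) The family $\{\gamma_{ij}\}_{i,j\in\mathbb N}$ is pointwise equicontinuous, and there is $\gamma^u_{\max}\in\mathcal K$ with $\gamma_{iu}\le\gamma_{\max}^u$ for all $i$. (iv) There is a path of strict decay for the gain operator $\Gamma(s)=(\sup_{j}\gamma_{ij}(s_j))_{i}$ on the cone $\ell_\infty^+$ of bounded nonnegative sequences, i.e. a map $\sigma:\mathbb R_+\to\ell_\infty^+$ such that: for some $\rho\in\mathcal K_\infty$, $\Gamma(\sigma(r))\le(\mathrm{id}+\rho)^{-1}(\sigma(r))$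 componentwise for all $r\ge0$; for some $\sigma_{\min},\sigma_{\max}\in\mathcal K_\infty$, $\sigma_{\min}\le\sigma_i\le\sigma_{\max}$ for all $i$; each $\sigma_i\in\mathcal K_\infty$; and for each compact interval $K\subset(0,\infty)$ there are $0<c\le C<\infty$ with $c|r_1-r_2|\le|\sigma_i^{-1}(r_1)-\sigma_i^{-1}(r_2)|\le C|r_1-r_2|$ for all $r_1,r_2\in K$ and $i\in\mathbb N$. (v) For each $R>0$ there is $L(R)>0$ with $|V_i(x_i)-V_i(y_i)|\le L(R)|x_i-y_i|$ for all $i$ and all $x_i,y_i\in E_i$ with $|x_i|,|y_i|<R$. (vi) There is $\tilde\alpha\in\mathcal P$ with $\alpha_i\ge\tilde\alpha$ for all $i$. Then $\Sigma$ is ISS. Moreover, the supremum $V(x):=\sup_{i\in\mathbb N}\sigma_i^{-1}(V_i(x_i))$ is finite for every $x\in X$, $V$ is an ISS Lyapunov function for $\Sigma$, and $V$ is locally Lipschitz continuous on $X\setminus\{0\}$. -/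

import Mathlib

open MeasureTheory Filter Set
open scoped NNReal ENNReal Topology

noncomputable section

namespace SmallGain

/-! Comparison functions on `ℝ₊`, modelled as maps `ℝ≥0 → ℝ≥0`. -/

/-- Class `P`: continuous, zero at zero, positive elsewhere. -/
structure ClassP (γ : ℝ≥0 → ℝ≥0) : Prop where
  continuous : Continuous γ
  map_zero : γ 0 = 0
  pos : ∀ r, 0 < r → 0 < γ r

/-- Class `K`: strictly increasing functions of class `P`. -/
structure ClassK (γ : ℝ≥0 → ℝ≥0) : Prop extends ClassP γ where
  strictMono : StrictMono γ

/-- Class `K∞`: unbounded functions of class `K`. -/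
structure ClassKInf (γ : ℝ≥0 → ℝ≥0) : Prop extends ClassK γ where
  unbounded : ¬ BddAbove (range γ)

/-- Class `L`: continuous, strictly decreasing, tending to zero. -/
structure ClassL (γ : ℝ≥0 → ℝ≥0) : Prop where
  continuous : Continuous γ
  strictAnti : StrictAnti γ
  tendsto_zero : Tendsto γ atTop (𝓝 0)

/-- Class `KL`. -/
structure ClassKL (β : ℝ≥0 → ℝ≥0 → ℝ≥0) : Prop where
  continuous : Continuous (fun p : ℝ≥0 × ℝ≥0 => β p.1 p.2)
  classK : ∀ t, ClassK (fun r => β r t)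
  classL : ∀ r, 0 < r → ClassL (β r)

/-! Networks. The spaces `E i` (states) and `W i` (external inputs) are finite-dimensional real
normed spaces, that is, `ℝ^{n_i}` and `ℝ^{m_i}` with arbitrary norms; finite-dimensionality is
assumed in the theorem only. -/

/-- A family of control systems `x_i' = f_i (x_i, (x_j)_{j ∈ I_i}, u_i)`, `i ∈ ℕ`, with finite
neighbour sets `I_i` and continuous right-hand sides. -/
structure Network (E W : ℕ → Type*) [∀ i, NormedAddCommGroup (E i)]
    [∀ i, NormedAddCommGroup (W i)] where
  /-- the neighbour sets `I_i` -/
  nbr : ℕ → Finset ℕ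
  self_notMem : ∀ i, i ∉ nbr i
  /-- the right-hand sides `f_i` -/
  f : ∀ i, E i → (∀ j : nbr i, E j) → W i → E i
  continuous_f : ∀ i,
    Continuous (fun p : E i × (∀ j : nbr i, E j) × W i => f i p.1 p.2.1 p.2.2)

/-- `u : ℝ₊ → U` is piecewise right-continuous: `ℝ₊` is partitioned into intervals
`[t_k, t_{k+1})` on each of which `u` is continuous. -/
def PiecewiseRightCts {U : Type*} [TopologicalSpace U] (u : ℝ → U) : Prop :=
  ∃ t : ℕ → ℝ, t 0 = 0 ∧ StrictMono t ∧ Tendsto t atTop atTop ∧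
    ∀ k, ContinuousOn u (Ico (t k) (t (k + 1)))

/-- The admissible input functions: `u ∈ L∞(ℝ₊, U)` with `U = ℓ∞(ℕ, (m_i))`, piecewise
right-continuous. The values of `u` at negative times play no role anywhere. -/
def Inputs (W : ℕ → Type*) [∀ i, NormedAddCommGroup (W i)] : Set (ℝ → lp W ∞) :=
  {u | MemLp u ∞ (volume.restrict (Ici (0 : ℝ))) ∧ PiecewiseRightCts u}

/-- The `L∞(ℝ₊, U)`-norm of an input, `ess sup_{t ≥ 0} ‖u t‖`. -/
def inputNorm {W : ℕ → Type*} [∀ i, NormedAddCommGroup (W i)] (u : Inputs W) : ℝ≥0 :=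
  (eLpNorm u.1 ∞ (volume.restrict (Ici (0 : ℝ)))).toNNReal

/-- The time interval `[0, T)`, where `T ≤ ∞`. -/
def timeDom (T : EReal) : Set ℝ := {t | 0 ≤ t ∧ (t : EReal) < T}

namespace Network

variable {E W : ℕ → Type*} [∀ i, NormedAddCommGroup (E i)] [∀ i, NormedSpace ℝ (E i)]
  [∀ i, NormedAddCommGroup (W i)]

/-- The right-hand side of the interconnection, `f(x,u) = (f_i(x_i, (x_j)_{j ∈ I_i}, u_i))_i`.
Its values need not lie in `X = ℓ∞(ℕ, (n_i))`. -/
def rhs (S : Network E W) (x : lp E ∞) (u : lp W ∞) : ∀ i, E i :=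
  fun i => S.f i (x i) (fun j => x j) (u i)

/-- `y : [0, T) → X` solves `x' = f(x,u)`, `x(0) = x₀`: the map `s ↦ f(y s, u s)` is a locally
integrable `X`-valued function `g` on `[0, T)` and `y t = x₀ + ∫₀ᵗ g`. -/
def IsSolution (S : Network E W) (u : Inputs W) (x₀ : lp E ∞) (T : EReal) (y : ℝ → lp E ∞) :
    Prop :=
  0 < T ∧ ∃ g : ℝ → lp E ∞,
    (∀ s ∈ timeDom T, (g s : ∀ i, E i) = S.rhs (y s) (u.1 s)) ∧
    LocallyIntegrableOn g (timeDom T) volume ∧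
    ∀ t ∈ timeDom T, y t = x₀ + ∫ s in (0 : ℝ)..t, g s

/-- A solution that has no proper extension to a solution on a larger interval `[0, T')`. -/
def IsMaximalSolution (S : Network E W) (u : Inputs W) (x₀ : lp E ∞) (T : EReal)
    (y : ℝ → lp E ∞) : Prop :=
  S.IsSolution u x₀ T y ∧
    ∀ (T' : EReal) (y' : ℝ → lp E ∞), T ≤ T' → S.IsSolution u x₀ T' y' →
      EqOn y' y (timeDom T) → T' = T

/-- Well-posedness: for all initial states and inputs there is a unique maximal solution. -/
def WellPosed (S : Network E W) : Prop :=
  ∀ (x₀ : lp E ∞) (u : Inputs W), ∃ (T : EReal) (y : ℝ → lp E ∞),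
    S.IsMaximalSolution u x₀ T y ∧
    ∀ (T' : EReal) (y' : ℝ → lp E ∞), S.IsMaximalSolution u x₀ T' y' →
      T' = T ∧ EqOn y' y (timeDom T)

/-- The maximal existence time `t_max(x₀, u)`. -/
def tMax {S : Network E W} (h : S.WellPosed) (x₀ : lp E ∞) (u : Inputs W) : EReal :=
  (h x₀ u).choose

/-- The maximal solution `φ(t, x₀, u)`, meaningful for `0 ≤ t < t_max(x₀, u)`. -/
def flow {S : Network E W} (h : S.WellPosed) (t : ℝ) (x₀ : lp E ∞) (u : Inputs W) : lp E ∞ :=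
  (h x₀ u).choose_spec.choose t

/-- Boundedness implies continuation: bounded maximal solutions are global. -/
def BIC {S : Network E W} (h : S.WellPosed) : Prop :=
  ∀ (x₀ : lp E ∞) (u : Inputs W),
    (∃ M : ℝ, ∀ t ∈ timeDom (tMax h x₀ u), ‖flow h t x₀ u‖ ≤ M) → tMax h x₀ u = ⊤

/-- Input-to-state stability (including forward completeness). -/
def ISS {S : Network E W} (h : S.WellPosed) : Prop :=
  (∀ (x₀ : lp E ∞) (u : Inputs W), tMax h x₀ u = ⊤) ∧
  ∃ (β : ℝ≥0 → ℝ≥0 → ℝ≥0) (γ : ℝ≥0 → ℝ≥0), ClassKL β ∧ ClassKInf γ ∧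
    ∀ (t : ℝ≥0) (x : lp E ∞) (u : Inputs W),
      ‖flow h t x u‖₊ ≤ β ‖x‖₊ t + γ (inputNorm u)

/-- The right upper Dini orbital derivative
`D⁺V_u(x) = limsup_{t → 0+} (V(φ(t,x,u)) - V(x)) / t`, with values in `[-∞, ∞]`. -/
def dini {S : Network E W} (h : S.WellPosed) (V : lp E ∞ → ℝ≥0) (x : lp E ∞) (u : Inputs W) :
    EReal :=
  limsup (fun t : ℝ => ((((V (flow h t x u) : ℝ) - (V x : ℝ)) / t : ℝ) : EReal)) (𝓝[>] 0)

/-- ISS Lyapunov functions (in implication form) for the interconnection. -/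
structure IsISSLyapunov {S : Network E W} (h : S.WellPosed) (V : lp E ∞ → ℝ≥0) : Prop where
  continuous : Continuous V
  coercive : ∃ ψ₁ ψ₂ : ℝ≥0 → ℝ≥0, ClassKInf ψ₁ ∧ ClassKInf ψ₂ ∧
    ∀ x, ψ₁ ‖x‖₊ ≤ V x ∧ V x ≤ ψ₂ ‖x‖₊
  decay : ∃ γ α : ℝ≥0 → ℝ≥0, ClassK γ ∧ ClassP α ∧
    ∀ (x : lp E ∞) (u : Inputs W), γ (inputNorm u) < V x →
      dini h V x u ≤ ((-(α (V x) : ℝ) : ℝ) : EReal)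

/-- `V i` is an ISS Lyapunov function for the `i`-th subsystem, for every `i`, with coercivity
bounds `ψ₁ i`, `ψ₂ i`, internal gains `γ i j`, external gains `γu i` and decay rates `α i`. -/
structure IsSubsystemISSLyapunov (S : Network E W) (V : ∀ i, E i → ℝ≥0)
    (ψ₁ ψ₂ : ℕ → ℝ≥0 → ℝ≥0) (γ : ℕ → ℕ → ℝ≥0 → ℝ≥0) (γu α : ℕ → ℝ≥0 → ℝ≥0) : Prop where
  continuous : ∀ i, Continuous (V i)
  contDiffOn : ∀ i, ContDiffOn ℝ 1 (fun y => (V i y : ℝ)) {0}ᶜ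
  lower_classKInf : ∀ i, ClassKInf (ψ₁ i)
  upper_classKInf : ∀ i, ClassKInf (ψ₂ i)
  coercive : ∀ i y, ψ₁ i ‖y‖₊ ≤ V i y ∧ V i y ≤ ψ₂ i ‖y‖₊
  internal_gain : ∀ i j, ClassK (γ i j) ∨ γ i j = 0
  internal_gain_eq_zero : ∀ i j, j ∉ S.nbr i → γ i j = 0
  external_gain : ∀ i, ClassK (γu i)
  rate : ∀ i, ClassP (α i)
  decay : ∀ (i : ℕ) (x : lp E ∞) (u : lp W ∞),
    max ((S.nbr i).sup fun j => γ i j (V j (x j))) (γu i ‖u i‖₊) < V i (x i) →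
      fderiv ℝ (fun y => (V i y : ℝ)) (x i) (S.f i (x i) (fun j => x j) (u i))
        ≤ -(α i (V i (x i)) : ℝ)

end Network

/-- The gain operator `Γ(s) = (sup_j γ_ij(s_j))_i` on nonnegative sequences. For gains that vanish
for all but finitely many `j`, the supremum is over a finite set of values. -/
def gainOp (γ : ℕ → ℕ → ℝ≥0 → ℝ≥0) (s : ℕ → ℝ≥0) : ℕ → ℝ≥0 :=
  fun i => ⨆ j, γ i j (s j)

/-- Paths of strict decay for the gain operator. Boundedness of each sequence `σ r` is part of
`bounds`. `Function.invFun` is the inverse function, as it is applied to bijections of `ℝ≥0`. -/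
structure IsPathOfStrictDecay (γ : ℕ → ℕ → ℝ≥0 → ℝ≥0) (σ : ℝ≥0 → ℕ → ℝ≥0) : Prop where
  decay : ∃ ρ : ℝ≥0 → ℝ≥0, ClassKInf ρ ∧
    ∀ r i, gainOp γ (σ r) i ≤ Function.invFun (fun s => s + ρ s) (σ r i)
  bounds : ∃ σmin σmax : ℝ≥0 → ℝ≥0, ClassKInf σmin ∧ ClassKInf σmax ∧
    ∀ i r, σmin r ≤ σ r i ∧ σ r i ≤ σmax r
  classKInf : ∀ i, ClassKInf (fun r => σ r i)
  biLipschitz : ∀ a b : ℝ≥0, 0 < a → a ≤ b → ∃ c C : ℝ, 0 < c ∧ c ≤ C ∧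
    ∀ r₁ ∈ Icc a b, ∀ r₂ ∈ Icc a b, ∀ i,
      c * dist r₁ r₂ ≤ dist (Function.invFun (fun r => σ r i) r₁)
        (Function.invFun (fun r => σ r i) r₂) ∧
      dist (Function.invFun (fun r => σ r i) r₁) (Function.invFun (fun r => σ r i) r₂)
        ≤ C * dist r₁ r₂

end SmallGain

end

open SmallGain

noncomputable section

namespace SmallGain

/-! ### Comparison functions -/

/-! Write `σ_i` for the components of the path and `V = sup_i σ_i⁻¹ ∘ V_i`. The difficulty is that
the supremum over infinitely many indices need not be attained, so the decay of each `V_i` must be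
turned into decay of `V` on a time interval common to all `i`.

Suppose `V = r > 0` at some time of a solution, with `r` large compared to the input. The uniform
bi-Lipschitz bound leaves room for levels `lo < r < hi` with `σ_i(hi) < (id + ρ)(σ_i(lo))` for all
`i` (`exists_levels`). By continuity `V ≤ hi` for a short time, so every `V_j ≤ σ_j(hi)`, and strict
decay of the path gives `γ_ij(V_j) ≤ (id + ρ)⁻¹(σ_i(hi)) < σ_i(lo)`. Hence, on this common interval,
each subsystem with `V_i ≥ σ_i(lo)` dominates its gains, and `V_i` decreases at a rate `m`
independent of `i`. A barrier argument bounds `V_i` by the larger of `σ_i(r) - m(τ - t)` and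
`σ_i(lo)`. Applying `σ_i⁻¹`, which contracts distances by at most a factor `c > 0`, yields `V ≤ r -
cm(τ - t)` (`exists_uniform_decay`).

The constant `cm` is uniform for `r` in compact subsets of `(0, ∞)`, so a class `P` rate can be
selected (`exists_classP_of_locally`). Comparison with a scalar equation gives a `KL` estimate
(`ClassP.exists_classKL`, `DecaysAlongSolutions.exists_bound`), and BIC makes solutions global.
Decay is established at every time of every solution, so no time shift of inputs and no semigroup
property is needed. -/

theorem _root_.OrderIso.classKInf (e : ℝ≥0 ≃o ℝ≥0) : ClassKInf e where
  continuous := e.continuous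
  map_zero := by simpa using e.map_bot
  pos r hr := by simpa using (show e 0 = 0 by simpa using e.map_bot) ▸ e.strictMono hr
  strictMono := e.strictMono
  unbounded := by rw [e.surjective.range_eq]; exact not_bddAbove_univ

theorem ClassKInf.surjective {g : ℝ≥0 → ℝ≥0} (hg : ClassKInf g) : Function.Surjective g := by
  intro y
  obtain ⟨_, ⟨r, rfl⟩, hr⟩ := not_bddAbove_iff.1 hg.unbounded y
  have h := intermediate_value_Icc (zero_le (a := r)) hg.continuous.continuousOn
  obtain ⟨x, -, hx⟩ := h ⟨by simp [hg.map_zero], hr.le⟩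
  exact ⟨x, hx⟩

/-- A class `K∞` function as an order isomorphism of `ℝ≥0`. -/
def ClassKInf.orderIso {g : ℝ≥0 → ℝ≥0} (hg : ClassKInf g) : ℝ≥0 ≃o ℝ≥0 :=
  hg.strictMono.orderIsoOfSurjective g hg.surjective

@[simp] theorem ClassKInf.orderIso_apply {g : ℝ≥0 → ℝ≥0} (hg : ClassKInf g) (r : ℝ≥0) :
    hg.orderIso r = g r := rfl

theorem ClassKInf.invFun_eq {g : ℝ≥0 → ℝ≥0} (hg : ClassKInf g) (r : ℝ≥0) :
    Function.invFun g r = hg.orderIso.symm r := by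
  apply hg.strictMono.injective
  rw [Function.invFun_eq (hg.surjective r)]
  exact (hg.orderIso.apply_symm_apply r).symm

theorem ClassK.comp {f g : ℝ≥0 → ℝ≥0} (hf : ClassK f) (hg : ClassK g) :
    ClassK (fun r => f (g r)) where
  continuous := hf.continuous.comp hg.continuous
  map_zero := by rw [hg.map_zero, hf.map_zero]
  pos r hr := hf.pos _ (hg.pos _ hr)
  strictMono := hf.strictMono.comp hg.strictMono

theorem ClassK.add_id {g : ℝ≥0 → ℝ≥0} (hg : ClassK g) : ClassKInf (fun r => g r + r) where
  continuous := hg.continuous.add continuous_id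
  map_zero := by simp [hg.map_zero]
  pos r hr := by positivity
  strictMono := hg.strictMono.add strictMono_id
  unbounded := by
    rw [not_bddAbove_iff]
    exact fun y => ⟨_, ⟨y + 1, rfl⟩, by
      have : y < y + 1 := by simp
      exact this.trans_le le_add_self⟩

theorem ClassKInf.id_add {ρ : ℝ≥0 → ℝ≥0} (hρ : ClassKInf ρ) : ClassKInf (fun s => s + ρ s) := by
  simpa only [add_comm] using hρ.toClassK.add_id

/-- A positive quantity on `(0, ∞)` that is locally bounded away from zero has a class `P`
minorant. -/
theorem exists_classP_of_locally (P : ℝ≥0 → ℝ → Prop)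
    (hmono : ∀ r a b, 0 < b → b ≤ a → P r a → P r b)
    (hloc : ∀ p q : ℝ≥0, 0 < p → p ≤ q → ∃ a : ℝ, 0 < a ∧ ∀ r ∈ Icc p q, P r a) :
    ∃ α : ℝ≥0 → ℝ≥0, ClassP α ∧ ∀ r, 0 < r → P r (α r) := by
  -- Admissible values form a convex set, so local constants glue to a continuous selection by a
  -- partition of unity. The cap `a ≤ r` makes the selection extend continuously by zero at the
  -- origin.
  let t : Ioi (0 : ℝ≥0) → Set ℝ := fun r => {a | 0 < a ∧ a ≤ (r : ℝ≥0) ∧ P r a}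
  obtain ⟨g, hg⟩ := exists_continuous_forall_mem_convex_of_local_const (t := t)
    (fun r => by
      apply Set.OrdConnected.convex
      refine ⟨fun a ha b hb c hc => ⟨ha.1.trans_le hc.1, hc.2.trans hb.2.1, ?_⟩⟩
      exact hmono _ _ _ (ha.1.trans_le hc.1) hc.2 hb.2.2)
    (fun r => by
      obtain ⟨r, hr⟩ := r
      have hr' : (0 : ℝ≥0) < r := hr
      obtain ⟨a, ha, hP⟩ := hloc (r / 2) (2 * r) (by positivity)
        (by rw [two_mul]; exact (half_le_self (zero_le (a := r))).trans le_self_add)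
      have hpos : (0 : ℝ) < ((r / 2 : ℝ≥0) : ℝ) := by positivity
      refine ⟨min a ((r / 2 : ℝ≥0) : ℝ), ?_⟩
      have hn : Icc (r / 2) (2 * r) ∈ 𝓝 r :=
        Icc_mem_nhds (NNReal.half_lt_self hr'.ne') (by
          rw [two_mul]; exact lt_add_of_pos_left r hr')
      filter_upwards [continuous_subtype_val.continuousAt.preimage_mem_nhds hn] with y hy
      refine ⟨lt_min ha hpos, (min_le_right _ _).trans (NNReal.coe_le_coe.2 hy.1), ?_⟩
      exact hmono _ _ _ (lt_min ha hpos) (min_le_left _ _) (hP _ hy))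
  let α : ℝ≥0 → ℝ≥0 := fun r => if h : 0 < r then (g ⟨r, h⟩).toNNReal else 0
  have hα : ∀ r (h : 0 < r), α r = (g ⟨r, h⟩).toNNReal := fun r h => by simp [α, h]
  have hle : ∀ r, α r ≤ r := by
    intro r
    rcases eq_or_ne r 0 with rfl | h
    · simp [α]
    · rw [hα r (pos_iff_ne_zero.2 h)]
      exact Real.toNNReal_le_iff_le_coe.2 (hg _).2.1
  refine ⟨α, ⟨?_, by simp [α], ?_⟩, ?_⟩
  · rw [continuous_iff_continuousAt]
    intro r
    rcases eq_or_ne r 0 with rfl | h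
    · have h0 : α 0 = 0 := by simp [α]
      rw [ContinuousAt, h0]
      exact tendsto_of_tendsto_of_tendsto_of_le_of_le tendsto_const_nhds
        (tendsto_id (x := 𝓝 (0 : ℝ≥0))) (fun _ => zero_le) hle
    · have hc : ContinuousOn α (Ioi 0) := by
        rw [continuousOn_iff_continuous_domRestrict]
        have : (Ioi (0 : ℝ≥0)).domRestrict α = fun r => (g r).toNNReal := by
          funext r
          exact hα r.1 r.2
        rw [this]
        exact continuous_real_toNNReal.comp g.continuous
      exact hc.continuousAt (Ioi_mem_nhds (pos_iff_ne_zero.2 h))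
  · intro r hr
    rw [hα r hr]
    exact Real.toNNReal_pos.2 (hg _).1
  · intro r hr
    rw [hα r hr, Real.coe_toNNReal _ (hg _).1.le]
    exact (hg ⟨r, hr⟩).2.2

/-! ### Comparison principle -/

/-- Real induction: the set where `w ≤ B` is closed, and it extends to the right of each of its
points, by continuity where `w < B` and by hypothesis at contact points. -/
theorem le_of_forall_eq_imp_eventually_le {w B : ℝ → ℝ} {s t : ℝ}
    (hw : ContinuousOn w (Icc s t)) (hB : ContinuousOn B (Icc s t)) (h0 : w s ≤ B s)
    (h : ∀ τ ∈ Ico s t, w τ = B τ → ∀ᶠ τ' in 𝓝[>] τ, w τ' ≤ B τ') :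
    ∀ τ ∈ Icc s t, w τ ≤ B τ := by
  have := IsClosed.Icc_subset_of_forall_mem_nhdsWithin (a := s) (b := t) (s := {τ | w τ ≤ B τ})
    (by
      have := hw.prodMk hB
      have := this.preimage_isClosed_of_isClosed isClosed_Icc OrderClosedTopology.isClosed_le'
      rwa [inter_comm] at this) h0
    (by
      rintro τ ⟨hτ, hτI⟩
      rcases eq_or_lt_of_le (show w τ ≤ B τ from hτ) with he | hl
      · exact h τ hτI he
      · have hn : 𝓝[>] τ ≤ 𝓝[Icc s t] τ :=
          (nhdsWithin_le_of_mem (mem_of_superset (Icc_mem_nhdsGT hτI.2)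
            (Icc_subset_Icc_left hτI.1)))
        have hτ' : τ ∈ Icc s t := ⟨hτI.1, hτI.2.le⟩
        filter_upwards [((hw τ hτ').mono_left hn).eventually_lt ((hB τ hτ').mono_left hn) hl]
          with τ' h' using h'.le)
  exact this

theorem eventually_le_of_hasDerivWithinAt {w : ℝ → ℝ} {w' m τ : ℝ}
    (h : HasDerivWithinAt w w' (Ici τ) τ) (hm : w' < m) :
    ∀ᶠ τ' in 𝓝[>] τ, w τ' ≤ w τ + m * (τ' - τ) := by
  have h1 := h.limsup_slope_le hm
  rw [Ici_sdiff_left] at h1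
  filter_upwards [h1, self_mem_nhdsWithin] with τ' h2 h3
  have h3' : 0 < τ' - τ := sub_pos.2 h3
  rw [slope_def_field, div_lt_iff₀ h3'] at h2
  linarith

theorem eventually_ge_of_hasDerivWithinAt {w : ℝ → ℝ} {w' m τ : ℝ}
    (h : HasDerivWithinAt w w' (Ici τ) τ) (hm : m < w') :
    ∀ᶠ τ' in 𝓝[>] τ, w τ + m * (τ' - τ) ≤ w τ' := by
  filter_upwards [eventually_le_of_hasDerivWithinAt h.neg (neg_lt_neg hm)] with τ' h'
  simp only [Pi.neg_apply] at h'
  linarith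

/-! ### Construction of class `KL` functions -/

/-- A primitive of `q` grows at least linearly with slope `c`, hence is onto. Its inverse solves a
separable equation for all time. -/
theorem exists_orderIso_hasDerivAt {q : ℝ → ℝ} (hq : Continuous q) {c : ℝ} (hc : 0 < c)
    (hcq : ∀ x, c ≤ q x) : ∃ H : ℝ ≃o ℝ, ∀ x, HasDerivAt H (q x) x := by
  let F : ℝ → ℝ := fun x => ∫ y in (0 : ℝ)..x, q y
  have hF : ∀ x, HasDerivAt F (q x) x := fun x =>
    (hq.integral_hasStrictDerivAt 0 x).hasDerivAt
  have hmono : StrictMono F := strictMono_of_hasDerivAt_pos hF fun x => hc.trans_le (hcq x)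
  have hG : Monotone fun x => F x - c * x := by
    refine monotone_of_hasDerivAt_nonneg (f' := fun x => q x - c) (fun x => ?_) fun x => ?_
    · simpa using (hF x).fun_sub ((hasDerivAt_id x).const_mul c)
    · exact sub_nonneg.2 (hcq x)
  have hF0 : F 0 = 0 := by simp [F]
  have hsurj : Function.Surjective F := by
    refine Continuous.surjective (continuous_iff_continuousAt.2 fun x => (hF x).continuousAt) ?_ ?_
    · refine tendsto_atTop_mono' _ ?_ ((tendsto_id (x := atTop)).const_mul_atTop hc)
      filter_upwards [eventually_ge_atTop 0] with x hx
      have := hG hx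
      simp only [hF0] at this
      simp only [id]
      linarith
    · refine tendsto_atBot_mono' _ ?_ ((tendsto_id (x := atBot)).const_mul_atBot hc)
      filter_upwards [eventually_le_atBot 0] with x hx
      have := hG hx
      simp only [hF0] at this
      simp only [id]
      linarith
  exact ⟨hmono.orderIsoOfSurjective F hsurj, hF⟩

/-- For each class `P` rate `α` there is a class `KL` function, starting at the identity, that
decays strictly more slowly than the solutions of `w' = -α(w)`. -/
theorem ClassP.exists_classKL {α : ℝ≥0 → ℝ≥0} (hα : ClassP α) :
    ∃ β : ℝ≥0 → ℝ≥0 → ℝ≥0, ClassKL β ∧ (∀ r, β r 0 = r) ∧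
      ∀ r, 0 < r → ∃ b : ℝ → ℝ, (∀ t : ℝ≥0, b t = β r t) ∧
        ∀ t, ∃ b', HasDerivAt b b' t ∧ -(α (b t).toNNReal : ℝ) < b' := by
  -- Slowing the rate to at most `r` makes `∫ dr / A(r)` diverge at both `0` and `∞`, so solutions
  -- neither reach zero nor blow up backwards.
  let A : ℝ → ℝ := fun r => min (α r.toNNReal) r
  have hA : Continuous A :=
    (NNReal.continuous_coe.comp (hα.continuous.comp continuous_real_toNNReal)).min continuous_id
  have hApos : ∀ r, 0 < r → 0 < A r := fun r hr =>
    lt_min (NNReal.coe_pos.2 (hα.pos _ (Real.toNNReal_pos.2 hr))) hr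
  -- With `r = exp l` this is the density of `2 dr / A(r)`, so `b` below solves `b' = -A(b)/2`. The
  -- factor 2 provides the strict inequality against `-α(b)`.
  let q : ℝ → ℝ := fun l => 2 * Real.exp l / A (Real.exp l)
  have hq : Continuous q := by
    refine Continuous.div (by fun_prop) (hA.comp Real.continuous_exp) fun l => ?_
    exact (hApos _ (Real.exp_pos l)).ne'
  have hq2 : ∀ l, 2 ≤ q l := by
    intro l
    have := hApos _ (Real.exp_pos l)
    rw [le_div_iff₀ this]
    have : A (Real.exp l) ≤ Real.exp l := min_le_right _ _
    linarith
  obtain ⟨H, hH⟩ := exists_orderIso_hasDerivAt hq two_pos hq2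
  let b : ℝ → ℝ → ℝ := fun r t => Real.exp (H.symm (H (Real.log r) - t))
  have hb_pos : ∀ r t, 0 < b r t := fun r t => Real.exp_pos _
  have hb_zero : ∀ r, 0 < r → b r 0 = r := fun r hr => by simp [b, Real.exp_log hr]
  have hb_anti : ∀ r, StrictAnti (b r) := fun r s t hst =>
    Real.exp_lt_exp.2 (H.symm.strictMono (by linarith))
  have hb_mono : ∀ t r s, 0 < r → r < s → b r t < b s t := fun t r s hr hrs =>
    Real.exp_lt_exp.2 (H.symm.strictMono (by
      have := H.strictMono (Real.log_lt_log hr hrs)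
      linarith))
  have hb_deriv : ∀ r t, HasDerivAt (b r) (-(A (b r t)) / 2) t := by
    intro r t
    set z := H.symm (H (Real.log r) - t) with hz
    have h1 : HasDerivAt H.symm (q z)⁻¹ (H (Real.log r) - t) :=
      HasDerivAt.of_local_left_inverse H.symm.continuous.continuousAt (hH _)
        (two_pos.trans_le (hq2 _)).ne' (Eventually.of_forall fun y => H.apply_symm_apply y)
    have h2 : HasDerivAt (fun t => H (Real.log r) - t) (-1) t := by
      simpa using (hasDerivAt_id t).const_sub (H (Real.log r))
    have h3 := (h1.comp t h2).exp
    refine h3.congr_deriv ?_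
    have h4 := hApos _ (Real.exp_pos z)
    have h5 := Real.exp_pos z
    simp only [Function.comp, ← hz, b, q]
    field_simp
  have hb_tendsto : ∀ r, Tendsto (b r) atTop (𝓝 0) := fun r =>
    Real.tendsto_exp_atBot.comp (H.symm.tendsto_atBot.comp
      (tendsto_atBot_add_const_left _ _ tendsto_neg_atTop_atBot))
  let β : ℝ≥0 → ℝ≥0 → ℝ≥0 := fun r t => if r = 0 then 0 else (b r t).toNNReal
  have hβ : ∀ r t, 0 < r → β r t = (b r t).toNNReal := fun r t hr => by simp [β, hr.ne']
  have hβ0 : ∀ t, β 0 t = 0 := fun t => by simp [β]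
  have hβc : ∀ r t, 0 < r → (β r t : ℝ) = b r t := fun r t hr => by
    rw [hβ r t hr, Real.coe_toNNReal _ (hb_pos _ _).le]
  have hβpos : ∀ r t, 0 < r → 0 < β r t := fun r t hr => by
    rw [hβ r t hr]; exact Real.toNNReal_pos.2 (hb_pos _ _)
  have hβle : ∀ r t, β r t ≤ r := by
    intro r t
    rcases eq_or_ne r 0 with rfl | h
    · simp [hβ0]
    · have hr := pos_iff_ne_zero.2 h
      rw [← NNReal.coe_le_coe, hβc r t hr]
      exact ((hb_anti r).antitone t.2).trans_eq (hb_zero r hr)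
  have hcont : Continuous (fun p : ℝ≥0 × ℝ≥0 => β p.1 p.2) := by
    rw [continuous_iff_continuousAt]
    rintro ⟨r, t⟩
    rcases eq_or_ne r 0 with rfl | h
    · rw [ContinuousAt]
      simp only [hβ0]
      exact tendsto_of_tendsto_of_tendsto_of_le_of_le tendsto_const_nhds
        (continuous_fst.tendsto ((0 : ℝ≥0), t)) (fun _ => zero_le) fun p => hβle p.1 p.2
    · have hr := pos_iff_ne_zero.2 h
      have h1 : ContinuousAt (fun p : ℝ≥0 × ℝ≥0 => (b p.1 p.2).toNNReal) (r, t) := by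
        refine continuous_real_toNNReal.continuousAt.comp ?_
        refine Real.continuous_exp.continuousAt.comp (H.symm.continuous.continuousAt.comp ?_)
        refine ContinuousAt.sub (H.continuous.continuousAt.comp ?_)
          (NNReal.continuous_coe.comp continuous_snd).continuousAt
        exact ContinuousAt.log (NNReal.continuous_coe.comp continuous_fst).continuousAt
          (NNReal.coe_ne_zero.2 h)
      refine h1.congr ?_
      filter_upwards [continuous_fst.continuousAt.preimage_mem_nhds (Ioi_mem_nhds hr)] with p hp
      exact (hβ p.1 p.2 hp).symm
  refine ⟨β, ⟨hcont, ?_, ?_⟩, ?_, ?_⟩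
  · intro t
    refine ⟨⟨hcont.comp (continuous_id.prodMk continuous_const), hβ0 t,
      fun r hr => hβpos r t hr⟩, ?_⟩
    intro r s hrs
    rcases eq_or_ne r 0 with rfl | h
    · simpa only [hβ0] using hβpos s t hrs
    · have hr := pos_iff_ne_zero.2 h
      rw [← NNReal.coe_lt_coe, hβc r t hr, hβc s t (hr.trans hrs)]
      exact hb_mono t r s hr hrs
  · intro r hr
    refine ⟨hcont.comp (continuous_const.prodMk continuous_id), ?_, ?_⟩
    · intro s t hst
      rw [← NNReal.coe_lt_coe, hβc r t hr, hβc r s hr]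
      exact hb_anti r hst
    · rw [← NNReal.tendsto_coe]
      simp only [hβc r _ hr]
      exact (hb_tendsto r).comp (NNReal.tendsto_coe_atTop.2 tendsto_id)
  · intro r
    rcases eq_or_ne r 0 with rfl | h
    · simp [hβ0]
    · have hr := pos_iff_ne_zero.2 h
      rw [← NNReal.coe_inj, hβc r 0 hr]
      exact hb_zero r hr
  · intro r hr
    refine ⟨b r, fun t => (hβc r t hr).symm, fun t => ⟨_, hb_deriv r t, ?_⟩⟩
    have h1 := hApos _ (hb_pos r t)
    have h2 : A (b r t) ≤ α (b r t).toNNReal := min_le_left _ _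
    linarith

/-! ### Time intervals and inputs -/

theorem Icc_subset_timeDom {T : EReal} {t : ℝ} (ht : t ∈ timeDom T) : Icc 0 t ⊆ timeDom T :=
  fun _ hs => ⟨hs.1, (EReal.coe_le_coe_iff.2 hs.2).trans_lt ht.2⟩

theorem exists_gt_mem_timeDom {T : EReal} {t : ℝ} (ht : t ∈ timeDom T) :
    ∃ t', t < t' ∧ t' ∈ timeDom T := by
  obtain ⟨t', h1, h2⟩ := EReal.lt_iff_exists_real_btwn.1 ht.2
  have h1' := EReal.coe_lt_coe_iff.1 h1
  exact ⟨t', h1', ht.1.trans h1'.le, h2⟩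

theorem PiecewiseRightCts.continuousWithinAt {U : Type*} [TopologicalSpace U] {u : ℝ → U}
    (hu : PiecewiseRightCts u) {t : ℝ} (ht : 0 ≤ t) : ContinuousWithinAt u (Ici t) t := by
  obtain ⟨p, hp0, hp, hpt, hc⟩ := hu
  obtain ⟨n, hn⟩ := (hpt.eventually_gt_atTop t).exists
  have hex : ∃ n, t < p n := ⟨n, hn⟩
  have h0 : Nat.find hex ≠ 0 := fun h => by
    have := Nat.find_spec hex
    rw [h, hp0] at this
    exact absurd ht (not_le.2 this)
  obtain ⟨k, hk⟩ := Nat.exists_eq_succ_of_ne_zero h0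
  have h1 : t < p (k + 1) := by
    have := Nat.find_spec hex
    rwa [hk] at this
  have h2 : p k ≤ t := not_lt.1 (Nat.find_min hex (by omega))
  exact (hc k t ⟨h2, h1⟩).mono_of_mem_nhdsWithin
    (mem_of_superset (Ico_mem_nhdsGE h1) (Ico_subset_Ico_left h2))

section Inputs

variable {W : ℕ → Type*} [∀ i, NormedAddCommGroup (W i)]

/-- By right continuity, exceeding the essential supremum at one time means exceeding it on an
interval of positive measure. -/
theorem nnnorm_le_inputNorm (u : Inputs W) {t : ℝ} (ht : 0 ≤ t) : ‖u.1 t‖₊ ≤ inputNorm u := by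
  by_contra! hlt
  have hcont := u.2.2.continuousWithinAt ht
  have hae : ∀ᵐ s ∂(volume.restrict (Ici (0 : ℝ))), ‖u.1 s‖₊ ≤ inputNorm u := by
    filter_upwards [ae_le_eLpNormEssSup (f := u.1) (μ := volume.restrict (Ici (0 : ℝ)))] with s hs
    rw [← eLpNorm_exponent_top] at hs
    have := ENNReal.toNNReal_mono u.2.1.eLpNorm_ne_top hs
    simpa [inputNorm] using this
  have hev : ∀ᶠ s in 𝓝[≥] t, inputNorm u < ‖u.1 s‖₊ :=
    (hcont.nnnorm).eventually_const_lt hlt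
  obtain ⟨t', htt', hsub⟩ := (mem_nhdsGE_iff_exists_Ico_subset).1 hev
  have hzero : volume (Ico t t') = 0 := by
    rw [ae_restrict_iff' measurableSet_Ici] at hae
    refine measure_mono_null ?_ (ae_iff.1 hae)
    intro s hs
    simp only [mem_ofPred_eq, Classical.not_imp, not_le]
    exact ⟨ht.trans hs.1, hsub hs⟩
  rw [Real.volume_Ico, ENNReal.ofReal_eq_zero] at hzero
  have : t < t' := htt'
  linarith

theorem nnnorm_apply_le_inputNorm (u : Inputs W) {t : ℝ} (ht : 0 ≤ t) (i : ℕ) :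
    ‖u.1 t i‖₊ ≤ inputNorm u :=
  (show ‖u.1 t i‖₊ ≤ ‖u.1 t‖₊ from lp.norm_apply_le_norm ENNReal.top_ne_zero (u.1 t) i).trans
    (nnnorm_le_inputNorm u ht)

end Inputs

/-! ### Solutions -/

namespace Network

variable {E W : ℕ → Type*} [∀ i, NormedAddCommGroup (E i)] [∀ i, NormedSpace ℝ (E i)]
  [∀ i, NormedAddCommGroup (W i)] {S : Network E W} {u : Inputs W} {x₀ : lp E ∞} {T : EReal}
  {y : ℝ → lp E ∞}

theorem IsSolution.zero_mem (h : S.IsSolution u x₀ T y) : (0 : ℝ) ∈ timeDom T :=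
  ⟨le_rfl, by simpa using h.1⟩

theorem IsSolution.apply_zero (h : S.IsSolution u x₀ T y) : y 0 = x₀ := by
  obtain ⟨-, g, -, -, hg⟩ := id h
  simpa using hg 0 h.zero_mem

theorem IsSolution.continuousOn_Icc (h : S.IsSolution u x₀ T y) {t : ℝ} (ht : t ∈ timeDom T) :
    ContinuousOn y (Icc 0 t) := by
  obtain ⟨-, g, -, hint, hg⟩ := h
  have h1 := hint.integrableOn_compact_subset (Icc_subset_timeDom ht) isCompact_Icc
  rw [← uIcc_of_le ht.1] at h1
  have h2 := intervalIntegral.continuousOn_primitive_interval h1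
  rw [uIcc_of_le ht.1] at h2
  exact (h2.const_add x₀).congr fun s hs => hg s (Icc_subset_timeDom ht hs)

theorem IsSolution.continuousWithinAt (h : S.IsSolution u x₀ T y) {t : ℝ}
    (ht : t ∈ timeDom T) : ContinuousWithinAt y (Ici t) t := by
  obtain ⟨t', htt', ht'⟩ := exists_gt_mem_timeDom ht
  exact (h.continuousOn_Icc ht' t ⟨ht.1, htt'.le⟩).mono_of_mem_nhdsWithin
    (mem_of_superset (Icc_mem_nhdsGE htt') (Icc_subset_Icc_left ht.1))

/-- The `X`-valued integrand need not be right-continuous in the sup norm. Each coordinate is, since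
`f_i` is continuous and sees only finitely many states, so the fundamental theorem of calculus
applies coordinatewise. -/
theorem IsSolution.hasDerivWithinAt_apply [∀ i, CompleteSpace (E i)]
    (h : S.IsSolution u x₀ T y) {t : ℝ} (ht : t ∈ timeDom T) (i : ℕ) :
    HasDerivWithinAt (fun τ => y τ i) (S.f i (y t i) (fun j => y t j) (u.1 t i)) (Ici t) t := by
  have hy := h.continuousWithinAt ht
  have hu := u.2.2.continuousWithinAt ht.1
  obtain ⟨-, g, hgrhs, hint, hg⟩ := h
  obtain ⟨t', htt', ht'⟩ := exists_gt_mem_timeDom ht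
  let e (j : ℕ) := lp.evalCLM ℝ E ∞ j
  let eW (j : ℕ) (w : lp W ∞) : W j := w j
  have heW : ∀ j, Continuous (eW j) := fun j => by
    refine LipschitzWith.continuous (K := 1) (LipschitzWith.of_dist_le_mul fun a b => ?_)
    have := lp.norm_apply_le_norm ENNReal.top_ne_zero (a - b) j
    simpa [dist_eq_norm, eW] using this
  have hInt : ∀ τ ∈ timeDom T, IntervalIntegrable g volume 0 τ := fun τ hτ =>
    (intervalIntegrable_iff_integrableOn_Icc_of_le hτ.1).2
      (hint.integrableOn_compact_subset (Icc_subset_timeDom hτ) isCompact_Icc)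
  have hmem : ∀ᶠ τ in 𝓝[≥] t, τ ∈ timeDom T := by
    filter_upwards [Icc_mem_nhdsGE htt'] with τ hτ
    exact Icc_subset_timeDom ht' ⟨ht.1.trans hτ.1, hτ.2⟩
  have heq : ∀ τ ∈ timeDom T, y τ i = x₀ i + ∫ s in (0 : ℝ)..τ, e i (g s) := by
    intro τ hτ
    rw [ContinuousLinearMap.intervalIntegral_comp_comm _ (hInt τ hτ), hg τ hτ]
    rfl
  have hgi : ∀ s ∈ timeDom T, e i (g s) = S.f i (y s i) (fun j => y s j) (u.1 s i) :=
    fun s hs => congrFun (hgrhs s hs) i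
  have hcont : ContinuousWithinAt (fun s => e i (g s)) (Ici t) t := by
    have h1 : ContinuousWithinAt (fun s => S.f i (e i (y s)) (fun j : S.nbr i => e j (y s))
        (eW i (u.1 s))) (Ici t) t := by
      refine (S.continuous_f i).continuousAt.comp_continuousWithinAt
        (f := fun s => (e i (y s), (fun j : S.nbr i => e j (y s)), eW i (u.1 s))) ?_
      refine ((e i).continuous.continuousAt.comp_continuousWithinAt hy).prodMk
        (ContinuousWithinAt.prodMk ?_ ((heW i).continuousAt.comp_continuousWithinAt hu))
      exact continuousWithinAt_pi.2 fun j =>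
        (e j).continuous.continuousAt.comp_continuousWithinAt hy
    refine h1.congr_of_eventuallyEq ?_ (hgi t ht)
    filter_upwards [hmem] with s hs using hgi s hs
  have hderiv : HasDerivWithinAt (fun τ => ∫ s in (0 : ℝ)..τ, e i (g s)) (e i (g t))
      (Ici t) t := by
    refine intervalIntegral.integral_hasDerivWithinAt_right (t := Ioi t) ?_ ?_
      (hcont.mono Ioi_subset_Ici_self)
    · exact ⟨(e i).integrable_comp (hInt t ht).1, (e i).integrable_comp (hInt t ht).2⟩
    · refine ⟨Ioc 0 t', mem_of_superset (Ioc_mem_nhdsGT htt') (Ioc_subset_Ioc_left ht.1), ?_⟩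
      exact ((e i).integrable_comp (hInt t' ht').1).aestronglyMeasurable
  rw [hgi t ht] at hderiv
  refine (hderiv.const_add (x₀ i)).congr_of_eventuallyEq ?_ (heq t ht)
  filter_upwards [hmem] with τ hτ using heq τ hτ

theorem isSolution_flow (h : S.WellPosed) (x₀ : lp E ∞) (u : Inputs W) :
    S.IsSolution u x₀ (tMax h x₀ u) (fun t => flow h t x₀ u) :=
  (h x₀ u).choose_spec.choose_spec.1.1

end Network

/-! ### Suprema of rescaled Lyapunov functions -/

/-- The scalings `s i` have common bounds, and their inverses are bi-Lipschitz on compact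
subintervals of `(0, ∞)`, uniformly in `i`. -/
structure IsUniformScaling (s : ℕ → ℝ≥0 ≃o ℝ≥0) (smin smax : ℝ≥0 ≃o ℝ≥0) : Prop where
  lower : ∀ i r, smin r ≤ s i r
  upper : ∀ i r, s i r ≤ smax r
  biLipschitz : ∀ a b : ℝ≥0, 0 < a → a ≤ b → ∃ c C : ℝ, 0 < c ∧ 0 < C ∧
    ∀ r₁ ∈ Icc a b, ∀ r₂ ∈ Icc a b, ∀ i,
      c * dist r₁ r₂ ≤ dist ((s i).symm r₁) ((s i).symm r₂) ∧
      dist ((s i).symm r₁) ((s i).symm r₂) ≤ C * dist r₁ r₂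

/-- The functions `V i` are coercive with common bounds. -/
structure IsUniformlyCoercive {E : ℕ → Type*} [∀ i, NormedAddCommGroup (E i)]
    (V : ∀ i, E i → ℝ≥0) (ψlo ψhi : ℝ≥0 ≃o ℝ≥0) : Prop where
  lower : ∀ i y, ψlo ‖y‖₊ ≤ V i y
  upper : ∀ i y, V i y ≤ ψhi ‖y‖₊

variable {E : ℕ → Type*} [∀ i, NormedAddCommGroup (E i)]

/-- The supremum of the rescaled functions `(s i)⁻¹ ∘ V i`. -/
def supLyapunov (s : ℕ → ℝ≥0 ≃o ℝ≥0) (V : ∀ i, E i → ℝ≥0) (x : lp E ∞) : ℝ≥0 :=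
  ⨆ i, (s i).symm (V i (x i))

variable {s : ℕ → ℝ≥0 ≃o ℝ≥0} {smin smax ψlo ψhi : ℝ≥0 ≃o ℝ≥0} {V : ∀ i, E i → ℝ≥0}

theorem nnnorm_lp_apply_le (x : lp E ∞) (i : ℕ) : ‖x i‖₊ ≤ ‖x‖₊ :=
  lp.norm_apply_le_norm ENNReal.top_ne_zero x i

theorem symm_le_of_scaling (hs : IsUniformScaling s smin smax) (hV : IsUniformlyCoercive V ψlo ψhi)
    (x : lp E ∞) (i : ℕ) : (s i).symm (V i (x i)) ≤ smin.symm (ψhi ‖x‖₊) := by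
  rw [OrderIso.symm_apply_le]
  refine (hV.upper i (x i)).trans ((ψhi.monotone (nnnorm_lp_apply_le x i)).trans ?_)
  simpa using hs.lower i (smin.symm (ψhi ‖x‖₊))

theorem isLUB_supLyapunov (hs : IsUniformScaling s smin smax)
    (hV : IsUniformlyCoercive V ψlo ψhi) (x : lp E ∞) :
    IsLUB (range fun i => (s i).symm (V i (x i))) (supLyapunov s V x) :=
  isLUB_ciSup ⟨_, forall_mem_range.2 (symm_le_of_scaling hs hV x)⟩

theorem supLyapunov_le (hs : IsUniformScaling s smin smax)
    (hV : IsUniformlyCoercive V ψlo ψhi) (x : lp E ∞) :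
    supLyapunov s V x ≤ smin.symm (ψhi ‖x‖₊) :=
  ciSup_le (symm_le_of_scaling hs hV x)

theorem le_scaling_supLyapunov (hs : IsUniformScaling s smin smax)
    (hV : IsUniformlyCoercive V ψlo ψhi) (x : lp E ∞) (i : ℕ) :
    V i (x i) ≤ s i (supLyapunov s V x) := by
  rw [← OrderIso.symm_apply_le]
  exact (isLUB_supLyapunov hs hV x).1 ⟨i, rfl⟩

theorem le_supLyapunov (hs : IsUniformScaling s smin smax)
    (hV : IsUniformlyCoercive V ψlo ψhi) (x : lp E ∞) :
    smax.symm (ψlo ‖x‖₊) ≤ supLyapunov s V x := by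
  rw [OrderIso.symm_apply_le, ← OrderIso.le_symm_apply, ← NNReal.coe_le_coe, coe_nnnorm]
  refine lp.norm_le_of_forall_le (NNReal.coe_nonneg _) fun i => ?_
  rw [← coe_nnnorm, NNReal.coe_le_coe, OrderIso.le_symm_apply]
  exact (hV.lower i (x i)).trans ((le_scaling_supLyapunov hs hV x i).trans (hs.upper i _))

theorem locallyLipschitzOn_supLyapunov (hs : IsUniformScaling s smin smax)
    (hV : IsUniformlyCoercive V ψlo ψhi)
    (hLip : ∀ R : ℝ, 0 < R → ∃ L : ℝ, 0 < L ∧ ∀ i, ∀ x ∈ Metric.ball (0 : E i) R,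
      ∀ y ∈ Metric.ball (0 : E i) R, |(V i x : ℝ) - (V i y : ℝ)| ≤ L * ‖x - y‖) :
    LocallyLipschitzOn {0}ᶜ (supLyapunov s V) := by
  intro x₀ hx₀
  have hn : 0 < ‖x₀‖₊ := nnnorm_pos.2 hx₀
  have hnR : 0 < ‖x₀‖ := norm_pos_iff.2 hx₀
  -- A lower bound for the supremum on the ball around `x₀`. Indices with `V i (x i) ≤ smin p`
  -- contribute at most `p`, so they cannot spoil the Lipschitz estimate.
  let p : ℝ≥0 := smax.symm (ψlo (‖x₀‖₊ / 2))
  have hpos : ∀ (e : ℝ≥0 ≃o ℝ≥0) {r}, 0 < r → 0 < e r := fun e r hr => e.classKInf.pos r hr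
  have hp : 0 < p := hpos _ (hpos _ (half_pos hn))
  let k : ℝ≥0 := smin p
  let K : ℝ≥0 := max k (ψhi (2 * ‖x₀‖₊))
  obtain ⟨c, C, -, hC, hcC⟩ := hs.biLipschitz k K (hpos _ hp) (le_max_left _ _)
  obtain ⟨L, hL, hVL⟩ := hLip (2 * ‖x₀‖) (by positivity)
  have hball : ∀ x ∈ Metric.ball x₀ (‖x₀‖ / 2), ‖x₀‖₊ / 2 ≤ ‖x‖₊ ∧ ‖x‖ < 2 * ‖x₀‖ := by
    intro x hx
    rw [Metric.mem_ball, dist_eq_norm] at hx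
    have h1 := norm_sub_norm_le x x₀
    have h2 := norm_sub_norm_le x₀ x
    rw [norm_sub_rev] at h2
    refine ⟨?_, by linarith⟩
    rw [← NNReal.coe_le_coe]
    push_cast
    linarith
  have hple : ∀ x ∈ Metric.ball x₀ (‖x₀‖ / 2), p ≤ supLyapunov s V x := fun x hx =>
    (smax.symm.monotone (ψlo.monotone (hball x hx).1)).trans (le_supLyapunov hs hV x)
  have hmem : ∀ x ∈ Metric.ball x₀ (‖x₀‖ / 2), ∀ i, V i (x i) ≤ K := by
    intro x hx i
    refine (hV.upper i (x i)).trans (le_trans (ψhi.monotone ?_) (le_max_right _ _))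
    exact (nnnorm_lp_apply_le x i).trans (hball x hx).2.le
  have hmemball : ∀ x ∈ Metric.ball x₀ (‖x₀‖ / 2), ∀ i,
      x i ∈ Metric.ball (0 : E i) (2 * ‖x₀‖) := by
    intro x hx i
    rw [mem_ball_zero_iff]
    exact (lp.norm_apply_le_norm ENNReal.top_ne_zero x i).trans_lt (hball x hx).2
  refine ⟨(C * L).toNNReal, Metric.ball x₀ (‖x₀‖ / 2),
    mem_nhdsWithin_of_mem_nhds (Metric.ball_mem_nhds _ (by positivity)), ?_⟩
  have key : ∀ x ∈ Metric.ball x₀ (‖x₀‖ / 2), ∀ z ∈ Metric.ball x₀ (‖x₀‖ / 2),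
      (supLyapunov s V x : ℝ) ≤ supLyapunov s V z + C * L * dist x z := by
    intro x hx z hz
    obtain ⟨D, hD⟩ : ∃ D : ℝ≥0, (D : ℝ) = C * L * dist x z := ⟨⟨_, by positivity⟩, rfl⟩
    have hle : supLyapunov s V x ≤ supLyapunov s V z + D := by
      refine ciSup_le fun i => ?_
      rcases le_total (V i (x i)) k with hk | hk
      · refine le_trans ?_ ((hple z hz).trans le_self_add)
        rw [OrderIso.symm_apply_le]
        exact hk.trans (hs.lower i p)
      -- Truncation at `k` keeps both arguments in `[k, K]`, where the inverse scalings are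
      -- uniformly Lipschitz, and does not increase the distance.
      · have h1 := (hcC (V i (x i)) ⟨hk, hmem x hx i⟩ (max (V i (z i)) k)
          ⟨le_max_right _ _, max_le (hmem z hz i) (le_max_left _ _)⟩ i).2
        have h2 : (s i).symm (max (V i (z i)) k) ≤ supLyapunov s V z := by
          rw [OrderIso.symm_apply_le]
          exact max_le (le_scaling_supLyapunov hs hV z i)
            ((hs.lower i p).trans ((s i).monotone (hple z hz)))
        have h3 : dist (V i (x i)) (max (V i (z i)) k) ≤ |(V i (x i) : ℝ) - V i (z i)| := by
          rw [NNReal.dist_eq, NNReal.coe_max]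
          have hk' : (k : ℝ) ≤ V i (x i) := NNReal.coe_le_coe.2 hk
          calc |(V i (x i) : ℝ) - max (V i (z i) : ℝ) k|
              = |max (V i (x i) : ℝ) k - max (V i (z i) : ℝ) k| := by rw [max_eq_left hk']
            _ ≤ _ := abs_max_sub_max_le_abs _ _ _
        have h4 := hVL i (x i) (hmemball x hx i) (z i) (hmemball z hz i)
        have h5 : ‖x i - z i‖ ≤ dist x z := by
          rw [dist_eq_norm]
          exact lp.norm_apply_le_norm ENNReal.top_ne_zero (x - z) i
        have h6 : C * dist (V i (x i)) (max (V i (z i)) k) ≤ C * L * dist x z := by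
          rw [mul_assoc]
          exact mul_le_mul_of_nonneg_left
            (h3.trans (h4.trans (mul_le_mul_of_nonneg_left h5 hL.le))) hC.le
        have h7 := (le_abs_self _).trans_eq (NNReal.dist_eq ((s i).symm (V i (x i)))
          ((s i).symm (max (V i (z i)) k))).symm
        rw [← NNReal.coe_le_coe] at h2 ⊢
        rw [NNReal.coe_add, hD]
        linarith
    rw [← NNReal.coe_le_coe, NNReal.coe_add, hD] at hle
    exact hle
  refine LipschitzOnWith.of_dist_le' fun x hx z hz => ?_
  have h1 := key x hx z hz
  have h2 := key z hz x hx
  rw [dist_comm z x] at h2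
  rw [NNReal.dist_eq, abs_le]
  constructor <;> linarith

theorem continuous_supLyapunov (hs : IsUniformScaling s smin smax)
    (hV : IsUniformlyCoercive V ψlo ψhi)
    (hLip : LocallyLipschitzOn {0}ᶜ (supLyapunov s V)) : Continuous (supLyapunov s V) := by
  rw [continuous_iff_continuousAt]
  intro x
  by_cases hx : x = 0
  · subst hx
    have hle := supLyapunov_le hs hV
    have hcont : Continuous fun x : lp E ∞ => smin.symm (ψhi ‖x‖₊) :=
      smin.symm.continuous.comp (ψhi.continuous.comp continuous_nnnorm)
    have h0 : smin.symm (ψhi ‖(0 : lp E ∞)‖₊) = 0 := by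
      rw [nnnorm_zero, ψhi.classKInf.map_zero, smin.symm.classKInf.map_zero]
    have h1 := hcont.tendsto 0
    rw [h0] at h1
    have h2 : supLyapunov s V 0 = 0 := le_antisymm ((hle 0).trans_eq h0) zero_le
    rw [ContinuousAt, h2]
    exact tendsto_of_tendsto_of_tendsto_of_le_of_le tendsto_const_nhds h1 (fun _ => zero_le) hle
  · exact hLip.continuousOn.continuousAt (isOpen_compl_singleton.mem_nhds hx)

/-! ### Uniform decay along solutions -/

/-- The slack `ρ (s i lo)` is at least `ρ (smin (r / 2))`, uniformly in `i`, while the lower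
bi-Lipschitz bound makes `s i hi - s i lo` uniformly small once `hi - lo` is. -/
theorem exists_levels {s : ℕ → ℝ≥0 ≃o ℝ≥0} {smin smax : ℝ≥0 ≃o ℝ≥0}
    (hs : IsUniformScaling s smin smax) {ρ : ℝ≥0 → ℝ≥0} (hρ : ClassKInf ρ)
    {r N : ℝ≥0} (hr : 0 < r) (hN : N < smin r) :
    ∃ lo hi : ℝ≥0, r / 2 ≤ lo ∧ lo < r ∧ r < hi ∧ hi ≤ 2 * r ∧ N < smin lo ∧
      ∀ i, s i hi < s i lo + ρ (s i lo) := by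
  have hpos : ∀ (e : ℝ≥0 ≃o ℝ≥0) {r}, 0 < r → 0 < e r := fun e r hr => e.classKInf.pos r hr
  have h2r : r / 2 ≤ 2 * r := by
    rw [two_mul]; exact (half_le_self (zero_le (a := r))).trans le_self_add
  obtain ⟨c, C, hc, -, hcC⟩ := hs.biLipschitz (smin (r / 2)) (smax (2 * r))
    (hpos _ (half_pos hr)) ((hs.lower 0 _).trans (((s 0).monotone h2r).trans (hs.upper 0 _)))
  let δ : ℝ≥0 := ρ (smin (r / 2))
  have hδ : 0 < δ := hρ.pos _ (hpos _ (half_pos hr))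
  have hcδ : 0 < c * δ := mul_pos hc (NNReal.coe_pos.2 hδ)
  have hlt : r < 2 * r := by rw [two_mul]; exact lt_add_of_pos_left r hr
  have hcoe : Tendsto (fun x : ℝ≥0 => (x : ℝ)) (𝓝 r) (𝓝 (r : ℝ)) :=
    NNReal.continuous_coe.tendsto r
  have : (𝓝[<] r).NeBot := nhdsLT_neBot_of_exists_lt ⟨0, hr⟩
  have e1 : ∀ᶠ lo in 𝓝[<] r, r / 2 ≤ lo ∧ N < smin lo ∧ (r : ℝ) - c * δ / 4 < lo := by
    refine nhdsWithin_le_nhds (((lt_mem_nhds (NNReal.half_lt_self hr.ne')).mono fun _ => le_of_lt).and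
      ((smin.continuous.continuousAt.eventually_const_lt hN).and
        (hcoe.eventually_const_lt (by linarith))))
  obtain ⟨lo, ⟨hlo1, hlo2, hlo3⟩, hlo4⟩ := (e1.and self_mem_nhdsWithin).exists
  have e2 : ∀ᶠ hi in 𝓝[>] r, hi ≤ 2 * r ∧ (hi : ℝ) < r + c * δ / 4 := by
    refine nhdsWithin_le_nhds (((gt_mem_nhds hlt).mono fun _ => le_of_lt).and
      (hcoe.eventually_lt_const (by linarith)))
  obtain ⟨hi, ⟨hhi1, hhi2⟩, hhi3⟩ := (e2.and self_mem_nhdsWithin).exists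
  refine ⟨lo, hi, hlo1, hlo4, hhi3, hhi1, hlo2, fun i => ?_⟩
  have hlohi : lo ≤ hi := (hlo4.trans hhi3).le
  have hm : ∀ z, r / 2 ≤ z → z ≤ 2 * r → s i z ∈ Icc (smin (r / 2)) (smax (2 * r)) :=
    fun z h1 h2 => ⟨(smin.monotone h1).trans (hs.lower i z),
      (hs.upper i z).trans (smax.monotone h2)⟩
  have h1 := (hcC (s i hi) (hm hi (hlo1.trans hlohi) hhi1) (s i lo)
    (hm lo hlo1 (hlohi.trans hhi1)) i).1
  rw [OrderIso.symm_apply_apply, OrderIso.symm_apply_apply, NNReal.dist_eq, NNReal.dist_eq,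
    abs_of_nonneg (sub_nonneg.2 (NNReal.coe_le_coe.2 ((s i).monotone hlohi))),
    abs_of_nonneg (sub_nonneg.2 (NNReal.coe_le_coe.2 hlohi))] at h1
  have h2 : c * ((s i hi : ℝ) - s i lo) < c * δ := by linarith
  have h3 := lt_of_mul_lt_mul_left h2 hc.le
  have h4 : δ ≤ ρ (s i lo) :=
    hρ.strictMono.monotone ((smin.monotone hlo1).trans (hs.lower i lo))
  rw [← NNReal.coe_le_coe] at h4
  rw [← NNReal.coe_lt_coe, NNReal.coe_add]
  linarith

namespace Network

variable {E W : ℕ → Type*} [∀ i, NormedAddCommGroup (E i)] [∀ i, NormedSpace ℝ (E i)]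
  [∀ i, NormedAddCommGroup (W i)]

theorem IsSubsystemISSLyapunov.gain_monotone {S : Network E W} {V : ∀ i, E i → ℝ≥0}
    {ψ₁ ψ₂ : ℕ → ℝ≥0 → ℝ≥0} {γ : ℕ → ℕ → ℝ≥0 → ℝ≥0} {γu α : ℕ → ℝ≥0 → ℝ≥0}
    (hV : S.IsSubsystemISSLyapunov V ψ₁ ψ₂ γ γu α) (i j : ℕ) : Monotone (γ i j) := by
  rcases hV.internal_gain i j with h | h
  · exact h.strictMono.monotone
  · rw [h]; exact monotone_const

theorem IsSubsystemISSLyapunov.gain_le_gainOp {S : Network E W} {V : ∀ i, E i → ℝ≥0}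
    {ψ₁ ψ₂ : ℕ → ℝ≥0 → ℝ≥0} {γ : ℕ → ℕ → ℝ≥0 → ℝ≥0} {γu α : ℕ → ℝ≥0 → ℝ≥0}
    (hV : S.IsSubsystemISSLyapunov V ψ₁ ψ₂ γ γu α) (s : ℕ → ℝ≥0) (i j : ℕ) :
    γ i j (s j) ≤ gainOp γ s i := by
  refine le_ciSup (f := fun j => γ i j (s j)) ⟨(S.nbr i).sup fun j => γ i j (s j), ?_⟩ j
  rintro _ ⟨j, rfl⟩
  by_cases hj : j ∈ S.nbr i
  · exact Finset.le_sup (f := fun j => γ i j (s j)) hj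
  · simp [hV.internal_gain_eq_zero i j hj]

/-- As long as a subsystem dominates its gains, its Lyapunov function decays along solutions. -/
theorem IsSubsystemISSLyapunov.eventually_le {S : Network E W} [∀ i, CompleteSpace (E i)]
    {V : ∀ i, E i → ℝ≥0}
    {ψ₁ ψ₂ : ℕ → ℝ≥0 → ℝ≥0} {γ : ℕ → ℕ → ℝ≥0 → ℝ≥0} {γu α : ℕ → ℝ≥0 → ℝ≥0}
    (hV : S.IsSubsystemISSLyapunov V ψ₁ ψ₂ γ γu α) {u : Inputs W} {x₀ : lp E ∞} {T : EReal}
    {y : ℝ → lp E ∞} (hy : S.IsSolution u x₀ T y) {t : ℝ} (ht : t ∈ timeDom T) {i : ℕ}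
    (hdom : max ((S.nbr i).sup fun j => γ i j (V j (y t j))) (γu i ‖u.1 t i‖₊) < V i (y t i))
    {m : ℝ} (hm : m < α i (V i (y t i))) :
    ∀ᶠ τ in 𝓝[>] t, (V i (y τ i) : ℝ) ≤ V i (y t i) - m * (τ - t) := by
  have hne : y t i ∈ ({0}ᶜ : Set (E i)) := by
    intro h0
    have h0' : y t i = 0 := h0
    have h1 := (hV.coercive i 0).2
    rw [nnnorm_zero, (hV.upper_classKInf i).map_zero] at h1
    rw [h0'] at hdom
    exact not_lt_bot (hdom.trans_le h1)
  have hdiff : DifferentiableAt ℝ (fun z => (V i z : ℝ)) (y t i) :=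
    ((hV.contDiffOn i).differentiableOn one_ne_zero).differentiableAt
      (isOpen_compl_singleton.mem_nhds hne)
  have h1 := hdiff.hasFDerivAt.comp_hasDerivWithinAt t (hy.hasDerivWithinAt_apply ht i)
  have h2 := eventually_le_of_hasDerivWithinAt h1
    ((hV.decay i (y t) (u.1 t) hdom).trans_lt (neg_lt_neg hm))
  filter_upwards [h2] with τ hτ
  simp only [Function.comp] at hτ
  linarith

theorem exists_uniform_decay {S : Network E W} [∀ i, CompleteSpace (E i)]
    {V : ∀ i, E i → ℝ≥0}
    {ψ₁ ψ₂ : ℕ → ℝ≥0 → ℝ≥0} {γ : ℕ → ℕ → ℝ≥0 → ℝ≥0} {γu α : ℕ → ℝ≥0 → ℝ≥0}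
    (hV : S.IsSubsystemISSLyapunov V ψ₁ ψ₂ γ γu α)
    {s : ℕ → ℝ≥0 ≃o ℝ≥0} {smin smax ψlo ψhi : ℝ≥0 ≃o ℝ≥0}
    (hs : IsUniformScaling s smin smax) (hVc : IsUniformlyCoercive V ψlo ψhi)
    (hcont : Continuous (supLyapunov s V))
    {ρ : ℝ≥0 → ℝ≥0} (hρ : ClassKInf ρ)
    (hgain : ∀ r i j, γ i j (s j r) ≤ hρ.id_add.orderIso.symm (s i r))
    {γmax : ℝ≥0 → ℝ≥0} (hγmax : ClassK γmax) (hγu : ∀ i r, γu i r ≤ γmax r)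
    {αlo : ℝ≥0 → ℝ≥0} (hαlo : ClassP αlo) (hα : ∀ i r, αlo r ≤ α i r)
    (p q : ℝ≥0) (hp : 0 < p) (hpq : p ≤ q) :
    ∃ a : ℝ, 0 < a ∧ ∀ r ∈ Icc p q, ∀ (u : Inputs W) (x₀ : lp E ∞) (T : EReal)
      (y : ℝ → lp E ∞), S.IsSolution u x₀ T y → ∀ t ∈ timeDom T,
      supLyapunov s V (y t) = r → γmax (inputNorm u) < smin r →
      ∀ᶠ τ in 𝓝[>] t, (supLyapunov s V (y τ) : ℝ) ≤ r - a * (τ - t) := by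
  have hpos : ∀ (e : ℝ≥0 ≃o ℝ≥0) {r}, 0 < r → 0 < e r := fun e r hr => e.classKInf.pos r hr
  let k : ℝ≥0 := smin (p / 2)
  let K : ℝ≥0 := smax (2 * q)
  have hk : 0 < k := hpos _ (half_pos hp)
  have hkK : k ≤ K := by
    refine (smin.monotone (?_ : p / 2 ≤ 2 * q)).trans ((hs.lower 0 _).trans (hs.upper 0 _))
    refine (half_le_self (zero_le (a := p))).trans (hpq.trans ?_)
    rw [two_mul]; exact le_self_add
  obtain ⟨c, C, hc, -, hcC⟩ := hs.biLipschitz k K hk hkK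
  -- `[k, K]` contains every value of `V i` between the levels `lo` and `hi`, for all `r ∈ [p, q]`
  -- and all `i`. Taking `m` strictly below the minimal rate there turns derivative bounds into
  -- increments.
  obtain ⟨v₀, hv₀, hmin⟩ := isCompact_Icc.exists_isMinOn (nonempty_Icc.2 hkK)
    hαlo.continuous.continuousOn
  have hαpos : 0 < (αlo v₀ : ℝ) := NNReal.coe_pos.2 (hαlo.pos _ (hk.trans_le hv₀.1))
  obtain ⟨m, hm, hmlt⟩ := exists_between hαpos
  have hmα : ∀ v ∈ Icc k K, ∀ i, m < α i v := fun v hv i =>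
    hmlt.trans_le (NNReal.coe_le_coe.2 ((hmin hv).trans (hα i v)))
  refine ⟨c * m, mul_pos hc hm, ?_⟩
  intro r hr u x₀ T y hy t ht hyr hu
  have hr0 : 0 < r := hp.trans_le hr.1
  obtain ⟨lo, hi, hlo1, hlo2, hhi1, hhi2, hlo3, hgap⟩ := exists_levels hs hρ hr0 hu
  have hplo : p / 2 ≤ lo := (by gcongr; exact hr.1 : p / 2 ≤ r / 2).trans hlo1
  have hhiq : hi ≤ 2 * q := hhi2.trans (by gcongr; exact hr.2)
  have hmemK : ∀ i v, s i lo ≤ v → v ≤ s i hi → v ∈ Icc k K := fun i v h1 h2 =>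
    ⟨((smin.monotone hplo).trans (hs.lower i lo)).trans h1,
      h2.trans ((hs.upper i hi).trans (smax.monotone hhiq))⟩
  -- Continuity of the supremum itself, rather than of each `V i`, is what makes `t₁` independent of
  -- `i`.
  obtain ⟨t₁, htt₁, ht₁, hless⟩ : ∃ t₁, t < t₁ ∧ t₁ ∈ timeDom T ∧
      ∀ τ ∈ Icc t t₁, supLyapunov s V (y τ) ≤ hi := by
    have h1 : ∀ᶠ τ in 𝓝[≥] t, supLyapunov s V (y τ) < hi :=
      (hcont.continuousAt.comp_continuousWithinAt
        (hy.continuousWithinAt ht)).eventually_lt_const (by simpa [hyr] using hhi1)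
    obtain ⟨t', htt', ht'⟩ := exists_gt_mem_timeDom ht
    obtain ⟨t₂, ht₂, hsub⟩ := mem_nhdsGE_iff_exists_Icc_subset.1 h1
    have ht₂' : t < t₂ := ht₂
    refine ⟨min t' t₂, lt_min htt' ht₂', Icc_subset_timeDom ht'
      ⟨ht.1.trans (lt_min htt' ht₂').le, min_le_left _ _⟩, fun τ hτ => ?_⟩
    exact le_of_lt (hsub ⟨hτ.1, hτ.2.trans (min_le_right _ _)⟩)
  have hdomT : ∀ τ ∈ Icc t t₁, τ ∈ timeDom T := fun τ hτ =>
    Icc_subset_timeDom ht₁ ⟨ht.1.trans hτ.1, hτ.2⟩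
  have hdecay : ∀ i, ∀ τ ∈ Ico t t₁, s i lo ≤ V i (y τ i) →
      ∀ᶠ τ' in 𝓝[>] τ, (V i (y τ' i) : ℝ) ≤ V i (y τ i) - m * (τ' - τ) := by
    intro i τ hτ hlow
    have hτ' : τ ∈ Icc t t₁ := ⟨hτ.1, hτ.2.le⟩
    have hup : ∀ j, V j (y τ j) ≤ s j hi := fun j =>
      (le_scaling_supLyapunov hs hVc (y τ) j).trans ((s j).monotone (hless τ hτ'))
    refine hV.eventually_le hy (hdomT τ hτ') (max_lt ?_ ?_)
      (hmα _ (hmemK i _ hlow (hup i)) i)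
    · have hlopos : 0 < s i lo := hpos _ ((half_pos hr0).trans_le hlo1)
      refine (Finset.sup_lt_iff (hlopos.trans_le hlow)).2 fun j _ => lt_of_lt_of_le ?_ hlow
      refine ((hV.gain_monotone i j (hup j)).trans (hgain hi i j)).trans_lt ?_
      rw [OrderIso.symm_apply_lt]
      exact hgap i
    · refine lt_of_le_of_lt ?_ (hlo3.trans_le ((hs.lower i lo).trans hlow))
      exact (hγu i _).trans (hγmax.strictMono.monotone
        (nnnorm_apply_le_inputNorm u (hdomT τ hτ').1 i))
  have hbar : ∀ i, ∀ τ ∈ Icc t t₁,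
      (V i (y τ i) : ℝ) ≤ max ((s i r : ℝ) - m * (τ - t)) (s i lo) := by
    intro i
    refine le_of_forall_eq_imp_eventually_le ?_ (by fun_prop) ?_ ?_
    · refine NNReal.continuous_coe.comp_continuousOn ((hV.continuous i).comp_continuousOn
        ((lp.evalCLM ℝ E ∞ i).continuous.comp_continuousOn
          ((hy.continuousOn_Icc ht₁).mono (Icc_subset_Icc_left ht.1))))
    · refine le_max_of_le_left ?_
      rw [sub_self, mul_zero, sub_zero, NNReal.coe_le_coe, ← hyr]
      exact le_scaling_supLyapunov hs hVc (y t) i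
    · intro τ hτ heq
      have h1 : s i lo ≤ V i (y τ i) := NNReal.coe_le_coe.1 ((le_max_right _ _).trans_eq heq.symm)
      filter_upwards [hdecay i τ hτ h1, self_mem_nhdsWithin] with τ' h2 h3
      have h3' : 0 ≤ m * (τ' - τ) := mul_nonneg hm.le (sub_nonneg.2 (le_of_lt h3))
      rcases max_cases ((s i r : ℝ) - m * (τ - t)) (s i lo) with ⟨h4, -⟩ | ⟨h4, -⟩
      · exact le_max_of_le_left (by rw [h4] at heq; linarith)
      · exact le_max_of_le_right (by rw [h4] at heq; linarith)
  -- Indices that have dropped to `s i lo` contribute at most `lo`, which stays below the target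
  -- line for `τ` near `t`.
  have hlate : ∀ᶠ τ in 𝓝[>] t, (lo : ℝ) < r - c * m * (τ - t) := by
    have h1 : ContinuousAt (fun τ => (r : ℝ) - c * m * (τ - t)) t := by fun_prop
    exact nhdsWithin_le_nhds (h1.eventually_const_lt (by simpa using hlo2))
  filter_upwards [hlate, Icc_mem_nhdsGT htt₁] with τ hτ1 hτ2
  obtain ⟨D, hD⟩ : ∃ D : ℝ≥0, (D : ℝ) = r - c * m * (τ - t) := ⟨⟨_, lo.2.trans hτ1.le⟩, rfl⟩
  rw [← hD]
  have hle : supLyapunov s V (y τ) ≤ D := by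
    refine ciSup_le fun i => ?_
    rw [← NNReal.coe_le_coe, hD]
    rcases le_or_gt (V i (y τ i)) (s i lo) with h1 | h1
    · rw [← OrderIso.symm_apply_le] at h1
      exact (NNReal.coe_le_coe.2 h1).trans hτ1.le
    · have h2 := hbar i τ hτ2
      have h3 : (V i (y τ i) : ℝ) ≤ (s i r : ℝ) - m * (τ - t) :=
        (le_max_iff.1 h2).resolve_right (not_le.2 (NNReal.coe_lt_coe.2 h1))
      have h4 : V i (y τ i) ≤ s i r := by
        rw [← NNReal.coe_le_coe]
        have := mul_nonneg hm.le (sub_nonneg.2 hτ2.1)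
        linarith
      -- The lower bi-Lipschitz constant converts a drop of `m(τ - t)` in `V i` into a drop of at
      -- least `cm(τ - t)` after rescaling.
      have h5 := (hcC (s i r) (hmemK i _ ((s i).monotone hlo2.le) ((s i).monotone hhi1.le))
        (V i (y τ i)) (hmemK i _ h1.le (h4.trans ((s i).monotone hhi1.le))) i).1
      have h6 : (s i).symm (V i (y τ i)) ≤ r := by rwa [OrderIso.symm_apply_le]
      rw [OrderIso.symm_apply_apply, NNReal.dist_eq, NNReal.dist_eq,
        abs_of_nonneg (sub_nonneg.2 (NNReal.coe_le_coe.2 h4)),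
        abs_of_nonneg (sub_nonneg.2 (NNReal.coe_le_coe.2 h6))] at h5
      have h7 : c * (m * (τ - t)) ≤ c * ((s i r : ℝ) - V i (y τ i)) :=
        mul_le_mul_of_nonneg_left (by linarith) hc.le
      linarith
  exact NNReal.coe_le_coe.2 hle

end Network
end SmallGain

namespace SmallGain
namespace Network

variable {E W : ℕ → Type*} [∀ i, NormedAddCommGroup (E i)] [∀ i, NormedSpace ℝ (E i)]
  [∀ i, NormedAddCommGroup (W i)] {S : Network E W}

/-! ### From decay along solutions to input-to-state stability -/

/-- Above the level `γ (inputNorm u)`, the function `V` decays along solutions at the rate `α`. -/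
def DecaysAlongSolutions (S : Network E W) (V : lp E ∞ → ℝ≥0) (γ α : ℝ≥0 → ℝ≥0) : Prop :=
  ∀ (u : Inputs W) (x₀ : lp E ∞) (T : EReal) (y : ℝ → lp E ∞), S.IsSolution u x₀ T y →
    ∀ t ∈ timeDom T, γ (inputNorm u) < V (y t) →
      ∀ᶠ τ in 𝓝[>] t, (V (y τ) : ℝ) ≤ V (y t) - α (V (y t)) * (τ - t)

theorem DecaysAlongSolutions.dini_le {V : lp E ∞ → ℝ≥0} {γ α : ℝ≥0 → ℝ≥0}
    (hV : S.DecaysAlongSolutions V γ α) (h : S.WellPosed) (x : lp E ∞) (u : Inputs W)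
    (hx : γ (inputNorm u) < V x) : dini h V x u ≤ ((-(α (V x) : ℝ) : ℝ) : EReal) := by
  have hsol := isSolution_flow h x u
  have h0 : flow h 0 x u = x := hsol.apply_zero
  have h1 := hV u x _ _ hsol 0 hsol.zero_mem (by simpa [h0] using hx)
  simp only [h0, sub_zero] at h1
  refine limsup_le_of_le (by isBoundedDefault) ?_
  filter_upwards [h1, self_mem_nhdsWithin] with t h2 h3
  rw [EReal.coe_le_coe_iff, div_le_iff₀ h3]
  linarith

theorem DecaysAlongSolutions.exists_bound {V : lp E ∞ → ℝ≥0} (hc : Continuous V)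
    {γ α : ℝ≥0 → ℝ≥0} (hα : ClassP α) (hV : S.DecaysAlongSolutions V γ α) :
    ∃ β : ℝ≥0 → ℝ≥0 → ℝ≥0, ClassKL β ∧
      ∀ (u : Inputs W) (x₀ : lp E ∞) (T : EReal) (y : ℝ → lp E ∞), S.IsSolution u x₀ T y →
        ∀ t : ℝ≥0, (t : ℝ) ∈ timeDom T → V (y t) ≤ max (β (V x₀) t) (γ (inputNorm u)) := by
  obtain ⟨β, hβ, hβ0, hb⟩ := hα.exists_classKL
  refine ⟨β, hβ, fun u x₀ T y hy t ht => ?_⟩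
  -- Raising the floor strictly above `γ (inputNorm u)` guarantees that decay holds wherever `V`
  -- touches the barrier `max b G`.
  refine le_of_forall_gt_imp_ge_of_dense fun G hG => ?_
  have hγG : γ (inputNorm u) < G := (le_max_right _ _).trans_lt hG
  refine le_trans ?_ (max_le (((le_max_left _ _).trans_lt hG).le) le_rfl : max (β (V x₀) t) G ≤ G)
  obtain ⟨b, hbβ, hbd⟩ : ∃ b : ℝ → ℝ, (∀ t : ℝ≥0, b t = β (V x₀) t) ∧
      ∀ t, ∃ b', HasDerivAt b b' t ∧
        (0 < (b t).toNNReal → -(α (b t).toNNReal : ℝ) < b') := by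
    -- For `V x₀ = 0` the barrier is zero and the strict derivative condition is vacuous.
    rcases eq_or_ne (V x₀) 0 with h0 | h0
    · refine ⟨fun _ => 0, fun t => ?_, fun t => ⟨0, hasDerivAt_const _ _, by simp⟩⟩
      simp [h0, (hβ.classK t).map_zero]
    · obtain ⟨b, h1, h2⟩ := hb _ (pos_iff_ne_zero.2 h0)
      refine ⟨b, h1, fun t => ?_⟩
      obtain ⟨b', h3, h4⟩ := h2 t
      exact ⟨b', h3, fun _ => h4⟩
  have hbc : Continuous b := continuous_iff_continuousAt.2 fun t => by
    obtain ⟨b', h, -⟩ := hbd t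
    exact h.continuousAt
  have key := le_of_forall_eq_imp_eventually_le (w := fun τ => (V (y τ) : ℝ))
    (B := fun τ => max (b τ) G) (s := 0) (t := t)
    (NNReal.continuous_coe.comp_continuousOn (hc.comp_continuousOn (hy.continuousOn_Icc ht)))
    (hbc.max continuous_const).continuousOn
    (by
      have := hbβ 0
      rw [hβ0, NNReal.coe_zero] at this
      rw [hy.apply_zero, this]
      exact le_max_left _ _)
    (by
      intro τ hτ heq
      have hGle : (G : ℝ) ≤ V (y τ) := (le_max_right _ _).trans_eq heq.symm
      have hdec := hV u x₀ T y hy τ (Icc_subset_timeDom ht ⟨hτ.1, hτ.2.le⟩)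
        (hγG.trans_le (NNReal.coe_le_coe.1 hGle))
      rcases max_cases (b τ) (G : ℝ) with ⟨h1, -⟩ | ⟨h1, -⟩
      · rw [h1] at heq
        obtain ⟨b', hb1, hb2⟩ := hbd τ
        have h2 : (b τ).toNNReal = V (y τ) := by rw [← heq, Real.toNNReal_coe]
        rw [h2] at hb2
        have h3 := eventually_ge_of_hasDerivWithinAt hb1.hasDerivWithinAt
          (hb2 ((zero_le.trans_lt hγG).trans_le (NNReal.coe_le_coe.1 hGle)))
        filter_upwards [hdec, h3] with τ' h4 h5
        exact le_max_of_le_left (by linarith)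
      · rw [h1] at heq
        filter_upwards [hdec, self_mem_nhdsWithin] with τ' h4 h5
        have h6 : (0 : ℝ) ≤ α (V (y τ)) * (τ' - τ) :=
          mul_nonneg (NNReal.coe_nonneg _) (sub_nonneg.2 (le_of_lt h5))
        exact le_max_of_le_right (by linarith))
  have h1 := key t ⟨t.2, le_rfl⟩
  rw [hbβ, ← NNReal.coe_max, NNReal.coe_le_coe] at h1
  exact h1

theorem DecaysAlongSolutions.iss {h : S.WellPosed} (hbic : BIC h) {V : lp E ∞ → ℝ≥0}
    (hc : Continuous V) {χ₁ χ₂ : ℝ≥0 ≃o ℝ≥0} (h₁ : ∀ x, χ₁ ‖x‖₊ ≤ V x) (h₂ : ∀ x, V x ≤ χ₂ ‖x‖₊)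
    {γ α : ℝ≥0 → ℝ≥0} (hγ : ClassK γ) (hα : ClassP α) (hV : S.DecaysAlongSolutions V γ α) :
    ISS h := by
  obtain ⟨β, hβ, hb⟩ := hV.exists_bound hc hα
  have hbound : ∀ (t : ℝ≥0) (x : lp E ∞) (u : Inputs W), (t : ℝ) ∈ timeDom (tMax h x u) →
      ‖flow h t x u‖₊ ≤ χ₁.symm (β (χ₂ ‖x‖₊) t) + χ₁.symm (γ (inputNorm u)) := by
    intro t x u ht
    have h3 := hb u x _ _ (isSolution_flow h x u) t ht
    have h4 : ‖flow h t x u‖₊ ≤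
        χ₁.symm (max (β (V x) t) (γ (inputNorm u))) := by
      rw [OrderIso.le_symm_apply]
      exact (h₁ _).trans h3
    refine h4.trans ?_
    rw [χ₁.symm.monotone.map_max]
    refine max_le (le_trans (χ₁.symm.monotone ?_) le_self_add) le_add_self
    exact (hβ.classK t).strictMono.monotone (h₂ x)
  have hglobal : ∀ (x : lp E ∞) (u : Inputs W), tMax h x u = ⊤ := by
    intro x u
    -- Since `β` is largest at time zero, this bounds the maximal solution on its whole interval.
    refine hbic x u ⟨(χ₁.symm (β (χ₂ ‖x‖₊) 0) + χ₁.symm (γ (inputNorm u)) : ℝ≥0), fun t ht => ?_⟩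
    lift t to ℝ≥0 using ht.1
    have h3 := hbound t x u ht
    rw [← coe_nnnorm, NNReal.coe_le_coe]
    refine h3.trans (add_le_add_left (χ₁.symm.monotone ?_) _)
    rcases eq_or_ne (χ₂ ‖x‖₊) 0 with h0 | h0
    · simp [h0, (hβ.classK _).map_zero]
    · exact (hβ.classL _ (pos_iff_ne_zero.2 h0)).strictAnti.antitone zero_le
  -- The summand `r` makes the gain unbounded, as `γ` is only of class `K`.
  refine ⟨hglobal, fun r t => χ₁.symm (β (χ₂ r) t), fun r => χ₁.symm (γ r) + r, ?_,
    (χ₁.symm.classKInf.toClassK.comp hγ).add_id, fun t x u => ?_⟩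
  · refine ⟨?_, fun t => ?_, fun r hr => ⟨?_, ?_, ?_⟩⟩
    · exact χ₁.symm.continuous.comp (hβ.continuous.comp
        ((χ₂.continuous.comp continuous_fst).prodMk continuous_snd))
    · exact χ₁.symm.classKInf.toClassK.comp ((hβ.classK t).comp χ₂.classKInf.toClassK)
    · exact χ₁.symm.continuous.comp (hβ.classL _ (χ₂.classKInf.pos r hr)).continuous
    · exact χ₁.symm.strictMono.comp_strictAnti (hβ.classL _ (χ₂.classKInf.pos r hr)).strictAnti
    · have := (χ₁.symm.continuous.tendsto 0).comp
        (hβ.classL _ (χ₂.classKInf.pos r hr)).tendsto_zero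
      rwa [χ₁.symm.classKInf.map_zero] at this
  · refine (hbound t x u ⟨t.2, ?_⟩).trans (add_le_add_right le_self_add _)
    rw [hglobal]
    exact EReal.coe_lt_top _

end Network
end SmallGain

end

/-! ### The small-gain theorem -/

theorem mainTheorem1 {E W : ℕ → Type*}
    [∀ i, NormedAddCommGroup (E i)] [∀ i, NormedSpace ℝ (E i)] [∀ i, FiniteDimensional ℝ (E i)]
    [∀ i, NormedAddCommGroup (W i)] [∀ i, NormedSpace ℝ (W i)] [∀ i, FiniteDimensional ℝ (W i)]
    (S : Network E W)
    -- (i) well-posedness and boundedness-implies-continuation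
    (hwp : S.WellPosed) (hbic : Network.BIC hwp)
    -- (ii) ISS Lyapunov functions for the subsystems, uniformly coercive
    (V : ∀ i, E i → ℝ≥0) (ψ₁ ψ₂ : ℕ → ℝ≥0 → ℝ≥0) (γ : ℕ → ℕ → ℝ≥0 → ℝ≥0)
    (γu α : ℕ → ℝ≥0 → ℝ≥0)
    (hV : S.IsSubsystemISSLyapunov V ψ₁ ψ₂ γ γu α)
    (hψ : ∃ ψlo ψhi : ℝ≥0 → ℝ≥0, ClassKInf ψlo ∧ ClassKInf ψhi ∧
      ∀ i r, ψlo r ≤ ψ₁ i r ∧ ψ₂ i r ≤ ψhi r)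
    -- (iii) equicontinuous internal gains, uniformly bounded external gains
    (hγ : Equicontinuous (fun p : ℕ × ℕ => γ p.1 p.2))
    (hγu : ∃ γmax : ℝ≥0 → ℝ≥0, ClassK γmax ∧ ∀ i r, γu i r ≤ γmax r)
    -- (iv) a path of strict decay
    (σ : ℝ≥0 → ℕ → ℝ≥0) (hσ : IsPathOfStrictDecay γ σ)
    -- (v) uniform local Lipschitz constants
    (hLip : ∀ R : ℝ, 0 < R → ∃ L : ℝ, 0 < L ∧ ∀ i, ∀ x ∈ Metric.ball (0 : E i) R,
      ∀ y ∈ Metric.ball (0 : E i) R, |(V i x : ℝ) - (V i y : ℝ)| ≤ L * ‖x - y‖)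
    -- (vi) a uniform decay rate
    (hα : ∃ αlo : ℝ≥0 → ℝ≥0, ClassP αlo ∧ ∀ i r, αlo r ≤ α i r) :
    Network.ISS hwp ∧
    ∃ Vsup : lp E ∞ → ℝ≥0,
      (∀ x : lp E ∞,
        IsLUB (range fun i => Function.invFun (fun r => σ r i) (V i (x i))) (Vsup x)) ∧
      Network.IsISSLyapunov hwp Vsup ∧
      LocallyLipschitzOn {0}ᶜ Vsup := by
  have hcomplete : ∀ i, CompleteSpace (E i) := fun i => FiniteDimensional.complete ℝ (E i)
  obtain ⟨ψlo, ψhi, hψlo, hψhi, hψ⟩ := hψ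
  obtain ⟨γmax, hγmax, hγu⟩ := hγu
  obtain ⟨αlo, hαlo, hα⟩ := hα
  obtain ⟨ρ, hρ, hσdecay⟩ := hσ.decay
  obtain ⟨σmin, σmax, hσmin, hσmax, hσb⟩ := hσ.bounds
  let s : ℕ → ℝ≥0 ≃o ℝ≥0 := fun i => (hσ.classKInf i).orderIso
  have hinv : ∀ i r, Function.invFun (fun r => σ r i) r = (s i).symm r := fun i =>
    (hσ.classKInf i).invFun_eq
  have hs : IsUniformScaling s hσmin.orderIso hσmax.orderIso := by
    refine ⟨fun i r => (hσb i r).1, fun i r => (hσb i r).2, fun a b ha hab => ?_⟩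
    obtain ⟨c, C, hc, hcC, h⟩ := hσ.biLipschitz a b ha hab
    simp only [hinv] at h
    exact ⟨c, C, hc, hc.trans_le hcC, h⟩
  have hVc : IsUniformlyCoercive V hψlo.orderIso hψhi.orderIso :=
    ⟨fun i y => (hψ i _).1.trans (hV.coercive i y).1,
      fun i y => (hV.coercive i y).2.trans (hψ i _).2⟩
  have hlip := locallyLipschitzOn_supLyapunov hs hVc hLip
  have hcont := continuous_supLyapunov hs hVc hlip
  have hgain : ∀ r i j, γ i j (s j r) ≤ hρ.id_add.orderIso.symm (s i r) := by
    intro r i j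
    have h := hσdecay r i
    rw [hρ.id_add.invFun_eq] at h
    exact (hV.gain_le_gainOp (σ r) i j).trans h
  obtain ⟨α', hα', hdecay⟩ := exists_classP_of_locally
    (fun r a => ∀ (u : Inputs W) (x₀ : lp E ∞) (T : EReal)
      (y : ℝ → lp E ∞), S.IsSolution u x₀ T y → ∀ t ∈ timeDom T,
      supLyapunov s V (y t) = r → γmax (inputNorm u) < hσmin.orderIso r →
      ∀ᶠ τ in 𝓝[>] t, (supLyapunov s V (y τ) : ℝ) ≤ r - a * (τ - t))
    (fun r a b _ hba h u x₀ T y hy t ht hr hu => by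
      filter_upwards [h u x₀ T y hy t ht hr hu, self_mem_nhdsWithin] with τ h1 h2
      have := mul_le_mul_of_nonneg_right hba (sub_nonneg.2 (le_of_lt h2))
      linarith)
    (Network.exists_uniform_decay hV hs hVc hcont hρ hgain hγmax hγu hαlo hα)
  have hγ' : ClassK fun r => hσmin.orderIso.symm (γmax r) :=
    hσmin.orderIso.symm.classKInf.toClassK.comp hγmax
  have hD : S.DecaysAlongSolutions (supLyapunov s V)
      (fun r => hσmin.orderIso.symm (γmax r)) α' := by
    intro u x₀ T y hy t ht hlt
    exact hdecay _ (zero_le.trans_lt hlt) u x₀ T y hy t ht rfl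
      ((OrderIso.symm_apply_lt _).1 hlt)
  let χ₁ : ℝ≥0 ≃o ℝ≥0 := hψlo.orderIso.trans hσmax.orderIso.symm
  let χ₂ : ℝ≥0 ≃o ℝ≥0 := hψhi.orderIso.trans hσmin.orderIso.symm
  have h₁ : ∀ x : lp E ∞, χ₁ ‖x‖₊ ≤ supLyapunov s V x := le_supLyapunov hs hVc
  have h₂ : ∀ x : lp E ∞, supLyapunov s V x ≤ χ₂ ‖x‖₊ := supLyapunov_le hs hVc
  refine ⟨hD.iss hbic hcont h₁ h₂ hγ' hα', supLyapunov s V, fun x => ?_, ⟨hcont, ?_, ?_⟩, hlip⟩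
  · simpa only [hinv] using isLUB_supLyapunov hs hVc x
  · exact ⟨χ₁, χ₂, χ₁.classKInf, χ₂.classKInf, fun x => ⟨h₁ x, h₂ x⟩⟩
  · exact ⟨_, α', hγ', hα', hD.dini_le hwp⟩
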